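/- For $r \ge 1$ let $T_r$ be the complete binary tree of height $r$ (root--leaf distance), let $P_{2r}$ be the path with $2r$ vertices, and let $G_r = T_r(P_{2r})$ be the graph with one copy of $P_{2r}$ for every vertex of $T_r$ in which, for every edge of $T_r$, equal vertices of the two corresponding copies are joined by an edge. Let $\varphi_r$ be the monotone 2-CNF whose variables are the vertices of $G_r$ and whose clauses are $(u \vee v)$ for the edges $\{u,v\}$ of $G_r$, and let $n = n_r = (2^{r+1}-1)\cdot 2r$ be its number of variables. A non-deterministic read-once branching program (NROBP) is a finite directed acyclic graph, possibly with multiple edges, with one root and one leaf, some of whose edges are labelled by literals in such a way that no directed path has two edges labelled by literals of the same variable; it implements the function whose satisfying assignments are those that extend the set of literals on some root--leaf path. Its size is the number of its edges. A (deterministic) read-once branching program (ROBP, or free binary decision diagram) is a finite directed acyclic graph with one root, whose leaves are labelled with truth values (at most one leaf per value) and in which every other node queries a variable and has one outgoing edge for each answer, no variable being queried twice on a directed path. Its size is the number of its nodes. A decision-DNNF is a de Morgan circuit (negations only on variables, constants allowed) in which distinct inputs of an AND-gate depend on disjoint sets of variables, and every OR-gate has exactly two inputs, both of them AND-gates, such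 that for some variable $x$ one of these has the input $x$ and the other the input $\neg x$. Its size is the number of its gates and wires. **Theorem.** There are constants $C, c > 0$ such that for every $r \ge 1$ there is a decision-DNNF $D_r$ computing $\varphi_r$ with size $|D_r| \le C\, n^5$, while every NROBP implementing $\varphi_r$ and every ROBP computing $\varphi_r$ has size at least $n^{(\log_2 n)/c}$, and also at least $|D_r|^{(\log_2 |D_r|)/c}$. (So the known quasi-polynomial simulation, of decision-DNNFs of size $N$ by ROBPs of size $N^{O(\log N)}$, is essentially tight.) -/

import Mathlib

noncomputable section

/-! ### CNF formulas and the formula of a graph -/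

/-- A literal over the variables `V`: the variable and its sign (`true` = positive literal). -/
abbrev Literal (V : Type) : Type := V × Bool

/-- The literal `l` is true under the assignment `a`. -/
def Literal.Holds {V : Type} (a : V → Bool) (l : Literal V) : Prop := a l.1 = l.2

/-- A CNF is a finite set of clauses, a clause is a finite set of literals. -/
abbrev CNF (V : Type) : Type := Finset (Finset (Literal V))

/-- The Boolean function of a CNF, as a predicate on truth assignments. -/
def CNF.Sat {V : Type} (φ : CNF V) (a : V → Bool) : Prop :=
  ∀ c ∈ φ, ∃ l ∈ c, Literal.Holds a l

open scoped Classical in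
/-- The monotone 2-CNF `φ(G)` of a graph `G`: its variables are the vertices of `G`
and its clauses are `(u ∨ v)` for the edges `{u, v}` of `G`. -/
def graphCNF {V : Type} [Fintype V] (G : SimpleGraph V) : CNF V :=
  G.edgeFinset.image fun e => e.toFinset.image fun v => (v, true)

/-! ### The graphs `T_r(P_{2r})` -/

/-- The vertices of the complete binary tree of height `r`: binary words of length at most `r`
(the empty word is the root, the children of `w` are `0w` and `1w`). -/
abbrev BinNode (r : ℕ) : Type := {w : List Bool // w.length ≤ r}

instance BinNode.instFinite (r : ℕ) : Finite (BinNode r) :=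
  (List.finite_length_le Bool r).to_subtype

instance BinNode.instFintype (r : ℕ) : Fintype (BinNode r) := Fintype.ofFinite _

/-- The complete binary tree `T_r` of height `r`. -/
def completeBinaryTree (r : ℕ) : SimpleGraph (BinNode r) where
  Adj s t := (∃ b : Bool, t.1 = b :: s.1) ∨ (∃ b : Bool, s.1 = b :: t.1)
  symm := ⟨fun _ _ h => h.symm⟩
  loopless := ⟨fun s h => by
    rcases h with ⟨b, h⟩ | ⟨b, h⟩ <;> simpa using congrArg List.length h⟩

/-- For a tree `T` and a graph `H`, the graph `T(H)` has one copy of `H` for every vertex of `T`;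
for adjacent vertices of `T`, equal vertices of the two corresponding copies are joined by an edge.
This is the box product of `T` and `H`. -/
def treeOfCopies {α β : Type} (T : SimpleGraph α) (H : SimpleGraph β) : SimpleGraph (α × β) :=
  T.boxProd H

/-- The vertex set of `T_r(P_{2r})`. -/
abbrev SepVertex (r : ℕ) : Type := BinNode r × Fin (2 * r)

/-- The graph `T_r(P_{2r})`, where `P_m` is the path with `m` vertices. -/
def sepGraph (r : ℕ) : SimpleGraph (SepVertex r) :=
  treeOfCopies (completeBinaryTree r) (SimpleGraph.pathGraph (2 * r))

/-- The CNF `φ(T_r(P_{2r}))`. -/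
def sepCNF (r : ℕ) : CNF (SepVertex r) := graphCNF (sepGraph r)

/-- The number `n` of variables of `φ(T_r(P_{2r}))`, that is, of vertices of `T_r(P_{2r})`
(which has no isolated vertices). -/
def sepNumVars (r : ℕ) : ℕ := Fintype.card (SepVertex r)

/-! ### Non-deterministic read-once branching programs -/

/-- A finite directed graph, possibly with multiple edges. -/
structure MultiDigraph where
  Node : Type
  Edge : Type
  [fintypeNode : Fintype Node]
  [fintypeEdge : Fintype Edge]
  src : Edge → Node
  tgt : Edge → Node

attribute [instance] MultiDigraph.fintypeNode MultiDigraph.fintypeEdge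

/-- `G.IsWalk u p v`: the edges `p` form, in this order, a directed walk from `u` to `v`
(in an acyclic graph, a directed path). -/
def MultiDigraph.IsWalk (G : MultiDigraph) : G.Node → List G.Edge → G.Node → Prop
  | u, [], v => u = v
  | u, e :: p, v => G.src e = u ∧ G.IsWalk (G.tgt e) p v

/-- A (syntactic) non-deterministic read-once branching program over the variables `V`:
a DAG, possibly with multiple edges, with one root (source) and one leaf (sink), some of whose
edges are labelled by literals so that no directed path has two edges labelled by literals
of the same variable. -/
structure NROBP (V : Type) extends MultiDigraph where
  label : Edge → Option (Literal V)
  root : Node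
  leaf : Node
  acyclic : ∀ v p, toMultiDigraph.IsWalk v p v → p = []
  root_iff : ∀ v, v = root ↔ ∀ e, tgt e ≠ v
  leaf_iff : ∀ v, v = leaf ↔ ∀ e, src e ≠ v
  readOnce : ∀ u p v, toMultiDigraph.IsWalk u p v →
    p.Pairwise fun e e' => ∀ l ∈ label e, ∀ l' ∈ label e', l.1 ≠ l'.1

/-- `Z` implements `F`: the satisfying assignments of `F` are exactly the assignments that
extend the set of literals on some path from the root to the leaf. -/
def NROBP.Computes {V : Type} (Z : NROBP V) (F : (V → Bool) → Prop) : Prop :=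
  ∀ a : V → Bool, F a ↔
    ∃ p, Z.IsWalk Z.root p Z.leaf ∧ ∀ e ∈ p, ∀ l ∈ Z.label e, Literal.Holds a l

/-- The size of an NROBP is its number of edges. -/
def NROBP.size {V : Type} (Z : NROBP V) : ℕ := Fintype.card Z.Edge

/-! ### Deterministic read-once branching programs -/

/-- The kind of a node of a branching program: a leaf labelled by a truth value, or a node that
queries a variable and has one outgoing edge for each of the two answers. -/
inductive BPKind (V N : Type) : Type
  | leaf (b : Bool) : BPKind V N
  | query (x : V) (next : Bool → N) : BPKind V N

/-- The program graph has an edge from `u` to `v`, labelled by the literal `l`. -/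
def BPStep {V N : Type} (kind : N → BPKind V N) (u : N) (l : Literal V) (v : N) : Prop :=
  ∃ next, kind u = BPKind.query l.1 next ∧ next l.2 = v

/-- There is a directed walk from `u` to `v` whose edges are labelled, in order, by `p`. -/
def BPWalk {V N : Type} (kind : N → BPKind V N) : N → List (Literal V) → N → Prop
  | u, [], v => u = v
  | u, l :: p, v => ∃ w, BPStep kind u l w ∧ BPWalk kind w p v

/-- A (syntactic, deterministic) read-once branching program, also known as free binary decision
diagram: a DAG with one root, with leaves labelled by the truth values (at most one leaf for each
value) and with every other node labelled by a variable and having one `true`- and one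
`false`-edge, where no variable is queried twice on a directed path. -/
structure ROBP (V : Type) where
  Node : Type
  [fintypeNode : Fintype Node]
  kind : Node → BPKind V Node
  root : Node
  acyclic : ∀ v p, BPWalk kind v p v → p = []
  root_iff : ∀ v, v = root ↔ ∀ u l, ¬ BPStep kind u l v
  leaf_unique : ∀ u v b, kind u = BPKind.leaf b → kind v = BPKind.leaf b → u = v
  readOnce : ∀ u p v, BPWalk kind u p v → (p.map Prod.fst).Nodup

attribute [instance] ROBP.fintypeNode

/-- `Z` computes `F`: the path from the root that follows the assignment `a` ends in the
`true`-leaf exactly if `F` is true on `a`. -/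
def ROBP.Computes {V : Type} (Z : ROBP V) (F : (V → Bool) → Prop) : Prop :=
  ∀ a : V → Bool, F a ↔
    ∃ p v, BPWalk Z.kind Z.root p v ∧ Z.kind v = BPKind.leaf true ∧ ∀ l ∈ p, Literal.Holds a l

/-- The size of an ROBP is its number of nodes. -/
def ROBP.size {V : Type} (Z : ROBP V) : ℕ := Fintype.card Z.Node

/-! ### Decision-DNNFs -/

/-- The kind of a gate of a de Morgan circuit: an input gate (a constant or a literal), or an
AND- or OR-gate with its set of in-neighbours. -/
inductive GateKind (V N : Type) : Type
  | const (b : Bool) : GateKind V N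
  | lit (l : Literal V) : GateKind V N
  | and (s : Finset N) : GateKind V N
  | or (s : Finset N) : GateKind V N

/-- The in-neighbours of a gate. -/
def GateKind.inputs {V N : Type} : GateKind V N → Finset N
  | .const _ => ∅
  | .lit _ => ∅
  | .and s => s
  | .or s => s

/-- A finite acyclic de Morgan circuit (negations only on variables) with one output gate. -/
structure DeMorganCircuit (V : Type) where
  Gate : Type
  [fintypeGate : Fintype Gate]
  kind : Gate → GateKind V Gate
  output : Gate
  acyclic : WellFounded fun h g => h ∈ (kind g).inputs

attribute [instance] DeMorganCircuit.fintypeGate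

namespace DeMorganCircuit

variable {V : Type}

/-- `D.Holds a g`: the gate `g` has value `true` under the assignment `a`. -/
inductive Holds (D : DeMorganCircuit V) (a : V → Bool) : D.Gate → Prop
  | const {g} : D.kind g = .const true → Holds D a g
  | lit {g l} : D.kind g = .lit l → Literal.Holds a l → Holds D a g
  | and {g s} : D.kind g = .and s → (∀ h ∈ s, Holds D a h) → Holds D a g
  | or {g s h} : D.kind g = .or s → h ∈ s → Holds D a h → Holds D a g

/-- The circuit `D` computes the Boolean function `F`. -/
def Computes (D : DeMorganCircuit V) (F : (V → Bool) → Prop) : Prop :=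
  ∀ a : V → Bool, F a ↔ D.Holds a D.output

/-- The variables from (a literal of) which the gate `g` can be reached. -/
def VReach (D : DeMorganCircuit V) (g : D.Gate) : Set V :=
  {x | ∃ h b, D.kind h = .lit (x, b) ∧
    Relation.ReflTransGen (fun h' g' => h' ∈ (D.kind g').inputs) h g}

/-- A DNNF: different in-neighbours of an AND-gate are reached from disjoint sets of variables. -/
def IsDNNF (D : DeMorganCircuit V) : Prop :=
  ∀ g s, D.kind g = .and s → ∀ h₁ ∈ s, ∀ h₂ ∈ s, h₁ ≠ h₂ → Disjoint (D.VReach h₁) (D.VReach h₂)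

/-- `g` is a decision node: it is an OR-gate with exactly two in-neighbours `y₁`, `y₂`, both are
AND-gates, and for some variable `x` the literal `x` is an input of `y₁` and the literal `¬x`
is an input of `y₂`. -/
def IsDecisionNode (D : DeMorganCircuit V) (g : D.Gate) : Prop :=
  ∃ s y₁ y₂ s₁ s₂ l₁ l₂ x, D.kind g = .or s ∧ y₁ ≠ y₂ ∧ (∀ h, h ∈ s ↔ h = y₁ ∨ h = y₂) ∧
    D.kind y₁ = .and s₁ ∧ l₁ ∈ s₁ ∧ D.kind l₁ = .lit (x, true) ∧
    D.kind y₂ = .and s₂ ∧ l₂ ∈ s₂ ∧ D.kind l₂ = .lit (x, false)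

/-- A decision-DNNF: a DNNF all of whose OR-gates are decision nodes. -/
def IsDecisionDNNF (D : DeMorganCircuit V) : Prop :=
  D.IsDNNF ∧ ∀ g s, D.kind g = .or s → D.IsDecisionNode g

/-- The size of a circuit: the number of its gates plus the number of its wires. -/
def size (D : DeMorganCircuit V) : ℕ :=
  Fintype.card D.Gate + ∑ g, (D.kind g).inputs.card

end DeMorganCircuit

end

/-! Upper bound: a circuit can assign the copies of the path from the root of the tree downwards,
remembering only the `2r` values on the current frontier. There are `2 ^ (2r)`, hence at most `n ^
2`, frontiers. Once a copy is fully assigned, the two subtrees below it share no variables, so a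
decomposable AND-gate splits the task.

A read-once program has no such AND-gates. Given an independent set `I`, follow an accepting walk
for the assignment that is false exactly on `I`, up to an edge `e` at which some set `S` of a
prescribed size `M` can be regarded as read. Accepting walks through `e` can be spliced there, so
for every graph edge leaving `S` one end must occur positively on all of them
(`Accepts.mem_forcedVars`). These forced vertices cover the cut of `S` and avoid `I`. In a graph of
maximum degree `d`, a set of `T` vertices is avoided by at most a fraction `(2 ^ d / (2 ^ d + 1)) ^
T` of the independent sets (`card_indepAvoiding_le`), so the program has exponentially many edges in
the least size `T` of such a cover (`pow_le_card_edge`).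

It remains to find `M` for which `T` is of order `r ^ 2` (`CoversCut.sq_le_card`). A cover `X` that
misses a copy forces this copy to lie on one side, so all columns of `S` have nearly the same size,
close to `2 ^ (r + 1) / 3` for the chosen `M`. In one column, a copy of the tree, the size of `S` is
a sum of few terms `± (2 ^ h - 1)` if few vertices cover the cut. But numbers near `2 ^ (r + 1) /
3`, with alternating binary digits, need order `r` such terms. `dyadicWeight` makes this precise: it
is subadditive, bounded on powers of two, tiny on small perturbations, and linear in the number of
scales at `2 ^ k / 3`. Thus each of the `2r` columns contains order `r` vertices of `X`. -/

/-! ### Independent sets avoiding a set of vertices -/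

section IndependentSets

open scoped Classical in
/-- The independent sets of `G` that avoid `X`. -/
noncomputable def indepAvoiding {V : Type} [Fintype V] (G : SimpleGraph V) (X : Finset V) : Finset (Finset V) :=
  Finset.univ.filter fun I => G.IsIndepSet (I : Set V) ∧ Disjoint I X

variable {V : Type} [Fintype V] {G : SimpleGraph V}

theorem mem_indepAvoiding {X I : Finset V} :
    I ∈ indepAvoiding G X ↔ G.IsIndepSet (I : Set V) ∧ Disjoint I X := by
  simp [indepAvoiding]

-- Exchange argument: delete the neighbours of `v` from an independent set without `v`, then add
-- `v`. The result together with the deleted part determines the original set, so sets without `v`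
-- are at most `2 ^ d` times as many as sets with `v`.
open scoped Classical in
theorem card_indepAvoiding_insert_le {d : ℕ} (hd : ∀ v, (G.neighborFinset v).card ≤ d)
    {X : Finset V} {v : V} (hv : v ∉ X) :
    (2 ^ d + 1) * (indepAvoiding G (insert v X)).card ≤ 2 ^ d * (indepAvoiding G X).card := by
  set N := G.neighborFinset v with hN
  set A := indepAvoiding G (insert v X) with hA
  set B := (indepAvoiding G X).filter (fun I => v ∈ I) with hB
  have hsplit : (indepAvoiding G X).card = A.card + B.card := by
    rw [hB, ← Finset.card_filter_add_card_filter_not (s := indepAvoiding G X) (fun I => v ∉ I)]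
    congr 2
    · ext I
      simp only [hA, Finset.mem_filter, mem_indepAvoiding, Finset.disjoint_insert_right]
      tauto
    · ext I
      simp
  have hmap : A.card ≤ B.card * (2 ^ d) := by
    have : A.card ≤ (B ×ˢ N.powerset).card := by
      refine Finset.card_le_card_of_injOn (fun I => (insert v (I \ N), I ∩ N)) ?_ ?_
      · intro I hI
        have hI' := mem_indepAvoiding.1 (Finset.mem_coe.1 hI)
        rw [Finset.disjoint_insert_right] at hI'
        obtain ⟨hind, hvI, hdis⟩ := hI'
        simp only [Finset.mem_coe, Finset.mem_product, Finset.mem_powerset, hB,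
          Finset.mem_filter, mem_indepAvoiding, Finset.mem_insert_self, and_true]
        refine ⟨⟨?_, ?_⟩, Finset.inter_subset_right⟩
        · intro a ha b hb hab hadj
          simp only [Finset.coe_insert, Finset.coe_sdiff, Set.mem_insert_iff, Set.mem_sdiff,
            Finset.mem_coe, hN, SimpleGraph.mem_neighborFinset] at ha hb
          rcases ha with rfl | ha <;> rcases hb with rfl | hb
          · exact hab rfl
          · exact hb.2 hadj
          · exact ha.2 hadj.symm
          · exact hind (Finset.mem_coe.2 ha.1) (Finset.mem_coe.2 hb.1) hab hadj
        · rw [Finset.disjoint_insert_left]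
          exact ⟨hv, hdis.mono_left Finset.sdiff_subset⟩
      · intro I hI J hJ hIJ
        have hI' := (mem_indepAvoiding.1 (Finset.mem_coe.1 hI)).2
        have hJ' := (mem_indepAvoiding.1 (Finset.mem_coe.1 hJ)).2
        rw [Finset.disjoint_insert_right] at hI' hJ'
        simp only [Prod.mk.injEq] at hIJ
        have h1 : I \ N = J \ N := by
          have := congrArg (fun K => K.erase v) hIJ.1
          rwa [Finset.erase_insert (by simp [hI'.1]), Finset.erase_insert (by simp [hJ'.1])] at this
        rw [← Finset.sdiff_union_inter I N, ← Finset.sdiff_union_inter J N, h1, hIJ.2]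
    rw [Finset.card_product, Finset.card_powerset] at this
    exact this.trans (Nat.mul_le_mul_left _ (Nat.pow_le_pow_right (by norm_num) (hd v)))
  rw [hsplit]
  nlinarith

-- Probabilistic reading: a uniformly random independent set avoids `X` with probability at most `(2
-- ^ d / (2 ^ d + 1)) ^ X.card`. Each further vertex contributes one factor.
open scoped Classical in
theorem card_indepAvoiding_le {d : ℕ} (hd : ∀ v, (G.neighborFinset v).card ≤ d) (X : Finset V) :
    (2 ^ d + 1) ^ X.card * (indepAvoiding G X).card
      ≤ (2 ^ d) ^ X.card * (indepAvoiding G ∅).card := by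
  induction X using Finset.induction_on with
  | empty => simp
  | insert v X hv ih =>
    rw [Finset.card_insert_of_notMem hv, pow_succ, pow_succ, mul_assoc]
    calc _ ≤ (2 ^ d + 1) ^ X.card * (2 ^ d * (indepAvoiding G X).card) :=
          Nat.mul_le_mul_left _ (card_indepAvoiding_insert_le hd hv)
      _ = 2 ^ d * ((2 ^ d + 1) ^ X.card * (indepAvoiding G X).card) := by ring
      _ ≤ 2 ^ d * ((2 ^ d) ^ X.card * (indepAvoiding G ∅).card) := Nat.mul_le_mul_left _ ih
      _ = _ := by ring

open scoped Classical in
/-- If every independent set avoids one of the sets `X i`, all of size at least `T`,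
then there are exponentially many indices. -/
theorem pow_le_card_of_indepSets_avoid {d : ℕ} (hd : ∀ v, (G.neighborFinset v).card ≤ d)
    {ι : Type} [Fintype ι] (X : ι → Finset V) (T : ℕ)
    (h : ∀ I : Finset V, G.IsIndepSet (I : Set V) → ∃ i, T ≤ (X i).card ∧ Disjoint I (X i)) :
    (2 ^ d + 1) ^ T ≤ (2 ^ d) ^ T * Fintype.card ι := by
  have hpos : 0 < (indepAvoiding G (∅ : Finset V)).card :=
    Finset.card_pos.2 ⟨∅, mem_indepAvoiding.2 ⟨by simp [SimpleGraph.IsIndepSet], by simp⟩⟩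
  set J : Finset ι := Finset.univ.filter fun i => T ≤ (X i).card with hJ
  have hX : ∀ i ∈ J, (2 ^ d + 1) ^ T * (indepAvoiding G (X i)).card
      ≤ (2 ^ d) ^ T * (indepAvoiding G ∅).card := by
    intro i hi
    -- Passing to exactly `T` vertices gives all indices the same bound; avoiding the larger set is
    -- only harder.
    obtain ⟨Y, hY, hYc⟩ := Finset.exists_subset_card_eq (Finset.mem_filter.1 hi).2
    have h1 := card_indepAvoiding_le hd Y
    rw [hYc] at h1
    refine le_trans (Nat.mul_le_mul_left _ (Finset.card_le_card fun I hI => ?_)) h1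
    rw [mem_indepAvoiding] at hI ⊢
    exact ⟨hI.1, hI.2.mono_right hY⟩
  have hcov : indepAvoiding G ∅ ⊆ J.biUnion fun i => indepAvoiding G (X i) := by
    intro I hI
    obtain ⟨i, hi, hdis⟩ := h I (mem_indepAvoiding.1 hI).1
    exact Finset.mem_biUnion.2 ⟨i, by simp [hJ, hi],
      mem_indepAvoiding.2 ⟨(mem_indepAvoiding.1 hI).1, hdis⟩⟩
  have h1 : (indepAvoiding G ∅).card ≤ ∑ i ∈ J, (indepAvoiding G (X i)).card :=
    (Finset.card_le_card hcov).trans Finset.card_biUnion_le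
  have h2 : (2 ^ d + 1) ^ T * (indepAvoiding G ∅).card
      ≤ Fintype.card ι * ((2 ^ d) ^ T * (indepAvoiding G ∅).card) := by
    calc _ ≤ (2 ^ d + 1) ^ T * ∑ i ∈ J, (indepAvoiding G (X i)).card := Nat.mul_le_mul_left _ h1
      _ = ∑ i ∈ J, (2 ^ d + 1) ^ T * (indepAvoiding G (X i)).card := Finset.mul_sum _ _ _
      _ ≤ ∑ _i ∈ J, (2 ^ d) ^ T * (indepAvoiding G ∅).card := Finset.sum_le_sum hX
      _ ≤ _ := by
        rw [Finset.sum_const, smul_eq_mul]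
        exact Nat.mul_le_mul_right _ (Finset.card_le_univ _)
  refine Nat.le_of_mul_le_mul_right ?_ hpos
  calc _ ≤ _ := h2
    _ = _ := by ring

end IndependentSets

/-! ### The lower bound for read-once programs -/

section ReadOnce

theorem graphCNF_sat_iff {V : Type} [Fintype V] {G : SimpleGraph V} {a : V → Bool} :
    (graphCNF G).Sat a ↔ ∀ u v, G.Adj u v → a u = true ∨ a v = true := by
  classical
  unfold CNF.Sat graphCNF
  constructor
  · intro h u v huv
    obtain ⟨l, hl, hla⟩ := h _ (Finset.mem_image_of_mem _
      (SimpleGraph.mem_edgeFinset.2 ((SimpleGraph.mem_edgeSet G).2 huv)))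
    obtain ⟨w, hw, rfl⟩ := Finset.mem_image.1 hl
    simp only [Sym2.mem_toFinset, Sym2.mem_iff] at hw
    rcases hw with rfl | rfl
    · exact Or.inl hla
    · exact Or.inr hla
  · intro h c hc
    obtain ⟨e, he, rfl⟩ := Finset.mem_image.1 hc
    induction e using Sym2.ind with
    | _ u v =>
      have huv : G.Adj u v := by simpa using he
      rcases h u v huv with h | h
      · exact ⟨(u, true), Finset.mem_image.2 ⟨u, by simp, rfl⟩, h⟩
      · exact ⟨(v, true), Finset.mem_image.2 ⟨v, by simp, rfl⟩, h⟩

theorem MultiDigraph.isWalk_append {H : MultiDigraph} {u v w : H.Node} {p q : List H.Edge}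
    (hp : H.IsWalk u p v) (hq : H.IsWalk v q w) : H.IsWalk u (p ++ q) w := by
  induction p generalizing u with
  | nil => cases hp; exact hq
  | cons e p ih => exact ⟨hp.1, ih hp.2⟩

theorem MultiDigraph.IsWalk.split {H : MultiDigraph} {u w : H.Node} {p : List H.Edge} {e : H.Edge}
    (hp : H.IsWalk u p w) (he : e ∈ p) :
    ∃ p₁ p₂, p = p₁ ++ e :: p₂ ∧ H.IsWalk u p₁ (H.src e) ∧ H.IsWalk (H.tgt e) p₂ w := by
  induction p generalizing u with
  | nil => simp at he
  | cons f p ih =>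
    by_cases hef : e = f
    · subst hef
      exact ⟨[], p, rfl, hp.1.symm, hp.2⟩
    · obtain ⟨p₁, p₂, rfl, h1, h2⟩ := ih hp.2 (by simpa [hef] using he)
      exact ⟨f :: p₁, p₂, rfl, ⟨hp.1, h1⟩, h2⟩

/-- A read-once labelling of a directed graph: no walk has two edges labelled by literals of
the same variable. -/
def IsReadOnce {V : Type} (H : MultiDigraph) (label : H.Edge → Option (Literal V)) : Prop :=
  ∀ u p v, H.IsWalk u p v → p.Pairwise fun e e' => ∀ l ∈ label e, ∀ l' ∈ label e', l.1 ≠ l'.1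

/-- The variables of the labels of a list of edges. -/
def labelVars {V E : Type} (label : E → Option (Literal V)) (p : List E) : Set V :=
  {x | ∃ e ∈ p, ∃ b, label e = some (x, b)}

/-- The variables that occur positively in the labels of a list of edges. -/
def posVars {V E : Type} (label : E → Option (Literal V)) (p : List E) : Set V :=
  {x | ∃ e ∈ p, label e = some (x, true)}

variable {V : Type} {G : SimpleGraph V} {H : MultiDigraph}
  {label : H.Edge → Option (Literal V)} {root leaf : H.Node}

theorem IsReadOnce.not_mem_of_append (hro : IsReadOnce H label) {u v w : H.Node}
    {p q : List H.Edge} (hp : H.IsWalk u p v) (hq : H.IsWalk v q w) {x : V}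
    (hx : x ∈ labelVars label p) : x ∉ labelVars label q := by
  rintro ⟨e', he', b', hl'⟩
  obtain ⟨e, he, b, hl⟩ := hx
  exact (List.pairwise_append.1 (hro _ _ _ (MultiDigraph.isWalk_append hp hq))).2.2 e he e' he'
    (x, b) hl (x, b') hl' rfl

/-- The variables read on some walk from `root` to `v`. -/
def varsBefore (label : H.Edge → Option (Literal V)) (root v : H.Node) : Set V :=
  {x | ∃ p, H.IsWalk root p v ∧ x ∈ labelVars label p}

/-- A closed walk can be traversed twice, so by the read-once property it carries no label.
Acyclicity is not needed, which later permits loops at leaves. -/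
theorem varsBefore_self (hro : IsReadOnce H label) : varsBefore label root root = ∅ := by
  ext x
  simp only [varsBefore, Set.mem_ofPred_eq, Set.mem_empty_iff_false, iff_false]
  rintro ⟨p, hp, hx⟩
  exact hro.not_mem_of_append hp hp hx hx

variable [Fintype V]

open scoped Classical in
/-- The variables read on some walk that starts in `root` and ends with the edge `e`. -/
noncomputable def readThrough (label : H.Edge → Option (Literal V)) (root : H.Node) (e : H.Edge) : Finset V :=
  (varsBefore label root (H.src e) ∪ labelVars label [e]).toFinset

open scoped Classical in
/-- The variables read on no walk from `v` to `leaf`. -/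
noncomputable def unreadAfter (label : H.Edge → Option (Literal V)) (leaf v : H.Node) : Finset V :=
  (varsBefore label v leaf)ᶜ.toFinset

theorem mem_readThrough {e : H.Edge} {x : V} : x ∈ readThrough label root e ↔
    x ∈ varsBefore label root (H.src e) ∨ x ∈ labelVars label [e] := by
  simp [readThrough]

theorem mem_unreadAfter {v : H.Node} {x : V} :
    x ∈ unreadAfter label leaf v ↔ x ∉ varsBefore label v leaf := by
  simp [unreadAfter]

/-- Any walk into `e` can be continued by any walk out of it, so a variable read on one of the
former occurs on none of the latter. This leaves room for a set of intermediate size. -/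
theorem readThrough_subset_unreadAfter (hro : IsReadOnce H label) (e : H.Edge) :
    readThrough label root e ⊆ unreadAfter label leaf (H.tgt e) := by
  intro x hx
  rw [mem_unreadAfter]
  rintro ⟨q, hq, hxq⟩
  rcases mem_readThrough.1 hx with ⟨p, hp, hxp⟩ | hxe
  · exact hro.not_mem_of_append hp (show H.IsWalk (H.src e) (e :: q) leaf from ⟨rfl, hq⟩) hxp
      (hxq.imp fun f hf => ⟨List.mem_cons_of_mem _ hf.1, hf.2⟩)
  · exact hro.not_mem_of_append (show H.IsWalk (H.src e) [e] (H.tgt e) from ⟨rfl, rfl⟩) hq hxe hxq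

/-- An edge reads at most one variable, so the count cannot jump over the target value. -/
theorem card_readThrough_le (e : H.Edge) :
    (readThrough label root e).card ≤ (varsBefore label root (H.src e)).ncard + 1 := by
  classical
  unfold readThrough
  rw [← Set.ncard_eq_toFinset_card']
  refine (Set.ncard_union_le _ _).trans (Nat.add_le_add_left ?_ _)
  refine (Set.ncard_le_one_iff (Set.toFinite _)).2 ?_
  rintro a b ⟨e₁, h₁, c₁, hl₁⟩ ⟨e₂, h₂, c₂, hl₂⟩
  simp only [List.mem_singleton] at h₁ h₂
  subst h₁ h₂
  rw [hl₁] at hl₂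
  simp only [Option.some.injEq, Prod.mk.injEq] at hl₂
  exact hl₂.1

/-- On every walk to the leaf there is an edge where a prescribed number `M` of variables can be
regarded as read. -/
theorem exists_edge_card_between (hro : IsReadOnce H label) {M : ℕ} (hM : M ≤ Fintype.card V)
    {u : H.Node} {p : List H.Edge} (hp : H.IsWalk u p leaf) (hne : p ≠ [])
    (hu : (varsBefore label root u).ncard < M) :
    ∃ e ∈ p, (readThrough label root e).card ≤ M ∧
      M ≤ (unreadAfter label leaf (H.tgt e)).card := by
  induction p generalizing u with
  | nil => exact absurd rfl hne
  | cons e p ih =>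
    obtain ⟨rfl, hp⟩ := hp
    -- The wanted edge is the first one where this holds. Before it, fewer than `M` variables have
    -- been read at the next node, which preserves the invariant `hu`; at the leaf all variables
    -- count as unread, so the search succeeds.
    by_cases h : M ≤ (unreadAfter label leaf (H.tgt e)).card
    · exact ⟨e, by simp, (card_readThrough_le e).trans hu, h⟩
    · have hne' : p ≠ [] := by
        rintro rfl
        cases hp
        refine h (hM.trans (le_of_eq ?_))
        rw [← Finset.card_univ]
        congr 1
        ext x
        simp [mem_unreadAfter, varsBefore_self hro]
      obtain ⟨f, hf, h1⟩ := ih hp hne' (by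
        refine lt_of_le_of_lt ?_ (not_le.1 h)
        rw [← Set.ncard_coe_finset]
        refine Set.ncard_le_ncard ?_ (Set.toFinite _)
        rintro x ⟨q, hq, hx⟩
        rw [Finset.mem_coe, mem_unreadAfter]
        rintro ⟨q', hq', hx'⟩
        exact hro.not_mem_of_append hq hq' hx hx')
      exact ⟨f, by simp [hf], h1⟩

/-- The labelled graph `H` accepts exactly the satisfying assignments of `F`. -/
def Accepts {V : Type} (label : H.Edge → Option (Literal V)) (root leaf : H.Node) (F : (V → Bool) → Prop) : Prop :=
  ∀ a : V → Bool, F a ↔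
    ∃ p, H.IsWalk root p leaf ∧ ∀ e ∈ p, ∀ l ∈ label e, Literal.Holds a l

/-- Setting true only the variables that occur positively on `p` is still consistent with `p`, since
no variable is read twice. This assignment is accepted and therefore satisfies the clause of the
edge. -/
theorem Accepts.mem_posVars (hro : IsReadOnce H label)
    (hacc : Accepts label root leaf (graphCNF G).Sat) {p : List H.Edge}
    (hp : H.IsWalk root p leaf) {u v : V} (huv : G.Adj u v) :
    u ∈ posVars label p ∨ v ∈ posVars label p := by
  classical
  have h := (hacc fun x => decide (x ∈ posVars label p)).2 ⟨p, hp, ?_⟩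
  · simpa using graphCNF_sat_iff.1 h u v huv
  · rintro e he ⟨x, b⟩ hl
    cases b with
    | true => simpa [Literal.Holds] using ⟨e, he, hl⟩
    | false =>
      simp only [Literal.Holds, decide_eq_false_iff_not]
      rintro ⟨f, hf, hlf⟩
      have hne : e ≠ f := by
        rintro rfl
        rw [Option.mem_def] at hl
        simp [hl] at hlf
      have hsymm : Std.Symm fun e e' : H.Edge =>
          ∀ l ∈ label e, ∀ l' ∈ label e', l.1 ≠ l'.1 :=
        ⟨fun _ _ h l hl l' hl' => (h l' hl' l hl).symm⟩
      exact (hro _ _ _ hp).forall he hf hne _ hl _ hlf rfl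

open scoped Classical in
/-- The variables that occur positively on all accepting walks through `e`. -/
noncomputable def forcedVars (label : H.Edge → Option (Literal V)) (root leaf : H.Node) (e : H.Edge) :
    Finset V :=
  Finset.univ.filter fun x => ∀ p, H.IsWalk root p leaf → e ∈ p → x ∈ posVars label p

/-- Splicing: if one accepting walk through `e` lacks `u` positively and another lacks `v`, join the
first part of the former to the last part of the latter. As `u` is not read after `e` and `v` not up
to `e`, the new accepting walk contains neither positively, against `Accepts.mem_posVars`. -/
theorem Accepts.mem_forcedVars (hro : IsReadOnce H label)
    (hacc : Accepts label root leaf (graphCNF G).Sat) {e : H.Edge} {S : Finset V}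
    (h₁ : readThrough label root e ⊆ S) (h₂ : S ⊆ unreadAfter label leaf (H.tgt e))
    {u v : V} (huv : G.Adj u v) (hu : u ∈ S) (hv : v ∉ S) :
    u ∈ forcedVars label root leaf e ∨ v ∈ forcedVars label root leaf e := by
  by_contra! hcon
  simp only [forcedVars, Finset.mem_filter, Finset.mem_univ, true_and, not_forall] at hcon
  obtain ⟨⟨P, hP, heP, huP⟩, ⟨Q, hQ, heQ, hvQ⟩⟩ := hcon
  obtain ⟨p₁, p₂, rfl, hp₁, hp₂⟩ := hP.split heP
  obtain ⟨q₁, q₂, rfl, hq₁, hq₂⟩ := hQ.split heQ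
  have hw : H.IsWalk root (p₁ ++ e :: q₂) leaf :=
    MultiDigraph.isWalk_append hp₁ (show H.IsWalk (H.src e) (e :: q₂) leaf from ⟨rfl, hq₂⟩)
  rcases hacc.mem_posVars hro hw huv with ⟨f, hf, hl⟩ | ⟨f, hf, hl⟩
  · simp only [List.mem_append, List.mem_cons] at hf
    rcases hf with hf | hf | hf
    · exact huP ⟨f, by simp [hf], hl⟩
    · exact huP ⟨f, by simp [hf], hl⟩
    · exact mem_unreadAfter.1 (h₂ hu) ⟨q₂, hq₂, f, hf, true, hl⟩
  · simp only [List.mem_append, List.mem_cons] at hf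
    rcases hf with hf | hf | hf
    · exact hv (h₁ (mem_readThrough.2 (Or.inl ⟨p₁, hp₁, f, hf, true, hl⟩)))
    · exact hv (h₁ (mem_readThrough.2 (Or.inr ⟨f, by simp [hf], true, hl⟩)))
    · exact hvQ ⟨f, by simp [hf], hl⟩

open scoped Classical in
/-- A read-once program for the CNF of a graph of maximum degree at most `d` is large if some
number `M` is such that all cuts with `M` vertices on one side need at least `T` vertices to cover
their edges. -/
theorem pow_le_card_edge {d : ℕ} (hd : ∀ v, (G.neighborFinset v).card ≤ d)
    (hro : IsReadOnce H label) (hacc : Accepts label root leaf (graphCNF G).Sat)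
    {M T : ℕ} (hM : 0 < M) (hMV : M ≤ Fintype.card V) (hG : ∃ u v, G.Adj u v)
    (hcut : ∀ S X : Finset V, S.card = M →
      (∀ u v, G.Adj u v → u ∈ S → v ∉ S → u ∈ X ∨ v ∈ X) → T ≤ X.card) :
    (2 ^ d + 1) ^ T ≤ (2 ^ d) ^ T * Fintype.card H.Edge := by
  refine pow_le_card_of_indepSets_avoid hd (forcedVars label root leaf) T fun I hI => ?_
  -- Independence of `I` says exactly that its complement is a vertex cover.
  have hsat : (graphCNF G).Sat fun x => decide (x ∉ I) := by
    rw [graphCNF_sat_iff]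
    intro u v huv
    by_contra! hcon
    simp only [decide_not, ne_eq, Bool.not_eq_true', decide_eq_false_iff_not, not_not] at hcon
    exact hI hcon.1 hcon.2 huv.ne huv
  obtain ⟨p, hp, hpa⟩ := (hacc _).1 hsat
  have hne : p ≠ [] := by
    rintro rfl
    obtain ⟨u, v, huv⟩ := hG
    simpa [posVars] using hacc.mem_posVars hro hp huv
  obtain ⟨e, he, h1, h2⟩ := exists_edge_card_between (root := root) hro hMV hp hne
    (by rwa [varsBefore_self hro, Set.ncard_empty])
  obtain ⟨S, hS1, hS2, hSM⟩ :=
    Finset.exists_subsuperset_card_eq (readThrough_subset_unreadAfter hro e) h1 h2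
  refine ⟨e, hcut S _ hSM fun u v huv hu hv => hacc.mem_forcedVars hro hS1 hS2 huv hu hv, ?_⟩
  rw [Finset.disjoint_left]
  intro x hxI hx
  obtain ⟨f, hf, hl⟩ := (Finset.mem_filter.1 hx).2 p hp he
  simpa [Literal.Holds, hxI] using hpa f hf _ hl

end ReadOnce

/-! ### Distance to the nearest integer at dyadic scales -/

section DyadicWeight

/-- The distance of a real number to the nearest integer. -/
noncomputable def distInt (x : ℝ) : ℝ := |x - round x|

theorem distInt_nonneg (x : ℝ) : 0 ≤ distInt x := abs_nonneg _

theorem distInt_le (x : ℝ) (z : ℤ) : distInt x ≤ |x - z| := round_le x z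

theorem distInt_le_abs (x : ℝ) : distInt x ≤ |x| := by simpa using distInt_le x 0

theorem distInt_add_le (x y : ℝ) : distInt (x + y) ≤ distInt x + distInt y := by
  refine (distInt_le (x + y) (round x + round y)).trans ?_
  have : x + y - ((round x + round y : ℤ) : ℝ) = (x - round x) + (y - round y) := by
    push_cast; ring
  rw [this]
  exact abs_add_le _ _

theorem distInt_neg (x : ℝ) : distInt (-x) = distInt x := by
  have key : ∀ y : ℝ, distInt (-y) ≤ distInt y := fun y => by
    refine (distInt_le (-y) (-round y)).trans (le_of_eq ?_)
    rw [distInt, ← abs_neg]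
    congr 1
    push_cast
    ring
  exact le_antisymm (key x) (by simpa using key (-x))

/-- The total distance of `n / 2 ^ (J + j)`, for `j < L`, to the nearest integer. It measures
how many powers of two are needed to write `n`. -/
noncomputable def dyadicWeight (J L : ℕ) (n : ℤ) : ℝ :=
  ∑ j ∈ Finset.range L, distInt ((n : ℝ) / 2 ^ (J + j))

theorem dyadicWeight_add_le (J L : ℕ) (m n : ℤ) :
    dyadicWeight J L (m + n) ≤ dyadicWeight J L m + dyadicWeight J L n := by
  unfold dyadicWeight
  rw [← Finset.sum_add_distrib]
  refine Finset.sum_le_sum fun j _ => ?_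
  rw [Int.cast_add, add_div]
  exact distInt_add_le _ _

theorem dyadicWeight_neg (J L : ℕ) (n : ℤ) : dyadicWeight J L (-n) = dyadicWeight J L n := by
  unfold dyadicWeight
  refine Finset.sum_congr rfl fun j _ => ?_
  rw [Int.cast_neg, neg_div, distInt_neg]

theorem dyadicWeight_sub_le (J L : ℕ) (m n : ℤ) :
    dyadicWeight J L (m - n) ≤ dyadicWeight J L m + dyadicWeight J L n := by
  rw [sub_eq_add_neg, ← dyadicWeight_neg J L n]
  exact dyadicWeight_add_le _ _ _ _

theorem dyadicWeight_zero (J L : ℕ) : dyadicWeight J L 0 = 0 := by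
  simp [dyadicWeight, distInt]

theorem sum_div_two_pow_le (c : ℝ) (hc : 0 ≤ c) (J L : ℕ) :
    ∑ j ∈ Finset.range L, c / 2 ^ (J + j) ≤ 2 * c / 2 ^ J := by
  have h : ∀ L : ℕ, ∑ j ∈ Finset.range L, c / 2 ^ (J + j) = 2 * c / 2 ^ J - 2 * c / 2 ^ (J + L) := by
    intro L
    induction L with
    | zero => simp
    | succ L ih =>
      rw [Finset.sum_range_succ, ih, ← add_assoc, pow_succ]
      field_simp
      ring
  rw [h]
  have : 0 ≤ 2 * c / 2 ^ (J + L) := by positivity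
  linarith

theorem dyadicWeight_le (J L : ℕ) (n : ℤ) : dyadicWeight J L n ≤ 2 * |(n : ℝ)| / 2 ^ J := by
  refine le_trans (Finset.sum_le_sum fun j _ => ?_) (sum_div_two_pow_le _ (abs_nonneg _) J L)
  refine (distInt_le_abs _).trans (le_of_eq ?_)
  rw [abs_div, abs_of_nonneg (by positivity : (0 : ℝ) ≤ 2 ^ (J + j))]

/-- Scales up to `h` divide `2 ^ h` and contribute nothing; the larger ones contribute at most `1/2
+ 1/4 + ...`. -/
theorem dyadicWeight_two_pow_le (J L h : ℕ) :
    dyadicWeight J L (2 ^ h) ≤ 1 := by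
  have key : ∀ j, h < j → distInt (((2 ^ h : ℤ) : ℝ) / 2 ^ j) ≤ 2 ^ h / 2 ^ j := by
    intro j _
    refine (distInt_le_abs _).trans (le_of_eq ?_)
    push_cast
    exact abs_of_nonneg (by positivity)
  have hzero : ∀ j, j ≤ h → distInt (((2 ^ h : ℤ) : ℝ) / 2 ^ j) = 0 := by
    intro j hj
    refine le_antisymm ((distInt_le _ (2 ^ (h - j))).trans (le_of_eq ?_)) (distInt_nonneg _)
    rw [abs_eq_zero, sub_eq_zero, div_eq_iff (by positivity)]
    push_cast
    rw [← pow_add, Nat.sub_add_cancel hj]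
  by_cases hJh : h < J
  · refine (dyadicWeight_le J L _).trans ?_
    rw [div_le_one (by positivity), Int.cast_pow, abs_of_nonneg (by positivity)]
    push_cast
    rw [← pow_succ']
    exact pow_le_pow_right₀ (by norm_num) hJh
  · obtain ⟨k, rfl⟩ := Nat.exists_eq_add_of_le (not_lt.1 hJh)
    by_cases hL : L ≤ k + 1
    · refine le_trans (Finset.sum_nonpos fun j hj => ?_) zero_le_one
      exact (hzero _ (by have := Finset.mem_range.1 hj; omega)).le
    · obtain ⟨L, rfl⟩ := Nat.exists_eq_add_of_le (not_le.1 hL).le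
      unfold dyadicWeight
      rw [Finset.sum_range_add, Finset.sum_eq_zero (fun j hj => hzero _ (by
        have := Finset.mem_range.1 hj; omega)), zero_add]
      refine le_trans (Finset.sum_le_sum fun j _ => key _ (by omega)) ?_
      have := sum_div_two_pow_le (2 ^ (J + k)) (by positivity) (J + k + 1) L
      refine le_trans (le_of_eq (Finset.sum_congr rfl fun j _ => ?_)) (this.trans (le_of_eq ?_))
      · congr 2
        ring
      · rw [pow_succ]
        field_simp

theorem dyadicWeight_two_pow_sub_one_le (J L h : ℕ) :
    dyadicWeight J L (2 ^ h - 1) ≤ 2 := by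
  have h1 := dyadicWeight_sub_le J L (2 ^ h) 1
  have h2 := dyadicWeight_two_pow_le J L h
  have h3 := dyadicWeight_two_pow_le J L 0
  rw [pow_zero] at h3
  linarith

/-- Since `3` does not divide `2 ^ (k - j)`, the exact quotient `2 ^ k / (3 * 2 ^ j)` is at distance
at least `1/3` from the integers. Rounding down the division by three moves it by at most `2 / (3 *
2 ^ j) ≤ 1/12`, by `3 ≤ j`. -/
theorem le_distInt_two_pow_div_three {k j : ℕ} (hj : 3 ≤ j) (hjk : j ≤ k) :
    (1 / 4 : ℝ) ≤ distInt (((2 ^ k / 3 : ℕ) : ℝ) / 2 ^ j) := by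
  set m := 2 ^ k / 3 with hm
  set z := round ((m : ℝ) / 2 ^ j) with hz
  obtain ⟨i, rfl⟩ := Nat.exists_eq_add_of_le hjk
  have h1 : ((3 * m : ℕ) : ℤ) ≤ 2 ^ (j + i) := by
    have : 3 * m ≤ 2 ^ (j + i) := by omega
    exact_mod_cast this
  have h2 : (2 : ℤ) ^ (j + i) ≤ ((3 * m : ℕ) : ℤ) + 2 := by
    have : 2 ^ (j + i) ≤ 3 * m + 2 := by omega
    exact_mod_cast this
  have h3 : (2 : ℤ) ^ i - 3 * z ≠ 0 := by
    intro h
    have : (3 : ℤ) ∣ 2 ^ i := ⟨z, by linarith⟩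
    have := Int.prime_three.dvd_of_dvd_pow this
    omega
  have h8 : (8 : ℤ) ≤ 2 ^ j := by
    calc (8 : ℤ) = 2 ^ 3 := by norm_num
      _ ≤ 2 ^ j := pow_le_pow_right₀ (by norm_num) hj
  have h4 : (3 : ℤ) * 2 ^ j ≤ 4 * |3 * (m : ℤ) - 3 * z * 2 ^ j| := by
    have h5 : 1 ≤ |(2 : ℤ) ^ i - 3 * z| := Int.one_le_abs h3
    have h6 : (2 : ℤ) ^ j ≤ |2 ^ j * ((2 : ℤ) ^ i - 3 * z)| := by
      rw [abs_mul, abs_of_pos (by positivity : (0 : ℤ) < 2 ^ j)]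
      nlinarith
    have h7 : (2 : ℤ) ^ j * (2 ^ i - 3 * z) = 2 ^ (j + i) - 3 * z * 2 ^ j := by ring
    rw [h7] at h6
    push_cast at h1 h2
    rcases abs_cases ((2 : ℤ) ^ (j + i) - 3 * z * 2 ^ j) with h | h <;>
    rcases abs_cases (3 * (m : ℤ) - 3 * z * 2 ^ j) with h' | h' <;> linarith
  have h9 : (3 : ℝ) * 2 ^ j ≤ 4 * |3 * (m : ℝ) - 3 * z * 2 ^ j| := by exact_mod_cast h4
  have h10 : 3 * (m : ℝ) - 3 * z * 2 ^ j = 3 * 2 ^ j * ((m : ℝ) / 2 ^ j - z) := by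
    field_simp
  rw [h10, abs_mul, abs_of_pos (by positivity : (0 : ℝ) < 3 * 2 ^ j)] at h9
  have h11 : (0 : ℝ) < 2 ^ j := by positivity
  unfold distInt
  rw [← hz]
  nlinarith

theorem le_dyadicWeight_two_pow_div_three {J L k : ℕ} (hJ : 3 ≤ J) (hk : J + L ≤ k + 1) :
    (L : ℝ) / 4 ≤ dyadicWeight J L ((2 ^ k / 3 : ℕ) : ℤ) := by
  unfold dyadicWeight
  calc (L : ℝ) / 4 = ∑ _j ∈ Finset.range L, (1 / 4 : ℝ) := by simp; ring
    _ ≤ _ := Finset.sum_le_sum fun j hj => by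
      have := Finset.mem_range.1 hj
      exact le_distInt_two_pow_div_three (by omega) (by omega)

end DyadicWeight

/-! ### Sums over complete binary trees -/

section TreeSum

/-- The sum of `f` over the nodes of the complete binary tree of height `h` rooted at `w`. -/
def treeSum {M : Type} [AddCommMonoid M] (f : List Bool → M) : ℕ → List Bool → M
  | 0, w => f w
  | h + 1, w => f w + (treeSum f h (false :: w) + treeSum f h (true :: w))

/-- The nodes of the complete binary tree of height `h` rooted at `w`. -/
def treeNodes : ℕ → List Bool → Finset (List Bool)
  | 0, w => {w}
  | h + 1, w => insert w (treeNodes h (false :: w) ∪ treeNodes h (true :: w))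

theorem mem_treeNodes {h : ℕ} {w v : List Bool} :
    v ∈ treeNodes h w ↔ ∃ u : List Bool, u.length ≤ h ∧ v = u ++ w := by
  induction h generalizing w with
  | zero => simp [treeNodes]
  | succ h ih =>
    simp only [treeNodes, Finset.mem_insert, Finset.mem_union, ih]
    constructor
    · rintro (rfl | ⟨u, hu, rfl⟩ | ⟨u, hu, rfl⟩)
      · exact ⟨[], by simp, rfl⟩
      · exact ⟨u ++ [false], by simpa using hu, by simp⟩
      · exact ⟨u ++ [true], by simpa using hu, by simp⟩
    · rintro ⟨u, hu, rfl⟩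
      rcases List.eq_nil_or_concat u with rfl | ⟨u, b, rfl⟩
      · simp
      · have hu' : u.length ≤ h := by simpa using hu
        cases b
        · exact Or.inr (Or.inl ⟨u, hu', by simp⟩)
        · exact Or.inr (Or.inr ⟨u, hu', by simp⟩)

theorem sum_treeNodes {M : Type} [AddCommMonoid M] (f : List Bool → M) (h : ℕ) (w : List Bool) :
    ∑ v ∈ treeNodes h w, f v = treeSum f h w := by
  induction h generalizing w with
  | zero => simp [treeNodes, treeSum]
  | succ h ih =>
    rw [treeNodes, Finset.sum_insert, Finset.sum_union, ih, ih, treeSum]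
    · rw [Finset.disjoint_left]
      intro v h1 h2
      obtain ⟨u, -, rfl⟩ := mem_treeNodes.1 h1
      obtain ⟨u', -, h3⟩ := mem_treeNodes.1 h2
      have := List.append_inj_right' h3 (by simp)
      simp at this
    · rw [Finset.mem_union, mem_treeNodes, mem_treeNodes]
      rintro (⟨u, -, h⟩ | ⟨u, -, h⟩) <;>
      · have := congrArg List.length h
        simp only [List.length_append, List.length_cons] at this
        omega

theorem sum_binNode {M : Type} [AddCommMonoid M] (f : List Bool → M) (r : ℕ) :
    ∑ w : BinNode r, f w.1 = treeSum f r [] := by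
  rw [← sum_treeNodes]
  refine Finset.sum_bij (fun w _ => w.1) ?_ ?_ ?_ ?_
  · intro w _
    exact mem_treeNodes.2 ⟨w.1, w.2, by simp⟩
  · intro a _ b _ h
    exact Subtype.ext h
  · intro v hv
    obtain ⟨u, hu, rfl⟩ := mem_treeNodes.1 hv
    exact ⟨⟨u ++ [], by simpa using hu⟩, Finset.mem_univ _, rfl⟩
  · simp

theorem treeSum_one (h : ℕ) (w : List Bool) : treeSum (fun _ => (1 : ℕ)) h w = 2 ^ (h + 1) - 1 := by
  induction h generalizing w with
  | zero => simp [treeSum]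
  | succ h ih =>
    rw [treeSum, ih, ih]
    have : 1 ≤ 2 ^ (h + 1) := Nat.one_le_two_pow
    rw [pow_succ 2 (h + 1)]
    omega

theorem card_binNode (r : ℕ) : Fintype.card (BinNode r) = 2 ^ (r + 1) - 1 := by
  rw [← treeSum_one r [], ← sum_binNode]
  simp

/-- The number of nodes of a tree in a set is, up to few terms of the form `± (2 ^ h - 1)`,
determined by the root if the edges of the tree that leave the set can be covered
by few nodes. -/
theorem dyadicWeight_treeSum_sub_le (J L : ℕ) (S X : List Bool → Prop)
    [DecidablePred S] [DecidablePred X] (h : ℕ) (w : List Bool)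
    (hSX : ∀ (b : Bool) (u : List Bool), u.length < w.length + h →
      (S (b :: u) ↔ S u) ∨ X (b :: u) ∨ X u) :
    dyadicWeight J L (treeSum (fun v => if S v then (1 : ℤ) else 0) h w
        - if S w then 2 ^ (h + 1) - 1 else 0)
      ≤ 2 * (3 * treeSum (fun v => if X v then (1 : ℝ) else 0) h w - if X w then 1 else 0) := by
  induction h generalizing w with
  | zero =>
    simp only [treeSum]
    have : ((if S w then (1 : ℤ) else 0) - if S w then 2 ^ (0 + 1) - 1 else 0) = 0 := by
      split_ifs <;> simp
    rw [this, dyadicWeight_zero]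
    split_ifs <;> norm_num
  | succ h ih =>
    -- Here the subtree at a child is compared with the prediction made from `w` instead of from the
    -- child. A wrong prediction costs the weight of `2 ^ (h + 1) - 1`, at most `2`, charged to an
    -- element of `X` on the edge. A node has at most three tree edges, whence the factor `3`; the
    -- subtracted term saves the charge for the edge to the parent.
    have step : ∀ b : Bool,
        dyadicWeight J L (treeSum (fun v => if S v then (1 : ℤ) else 0) h (b :: w)
          - if S w then 2 ^ (h + 1) - 1 else 0)
        ≤ 2 * (3 * treeSum (fun v => if X v then (1 : ℝ) else 0) h (b :: w)
          + if X w then 1 else 0) := by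
      intro b
      have h1 := ih (b :: w) (fun b' u hu => hSX b' u (by simp at hu; omega))
      have h0 := dyadicWeight_two_pow_sub_one_le J L (h + 1)
      set A := treeSum (fun v => if S v then (1 : ℤ) else 0) h (b :: w)
      set B := treeSum (fun v => if X v then (1 : ℝ) else 0) h (b :: w)
      have hsplit : (A - if S w then 2 ^ (h + 1) - 1 else 0)
          = (A - if S (b :: w) then 2 ^ (h + 1) - 1 else 0)
          + ((if S (b :: w) then (2 : ℤ) ^ (h + 1) - 1 else 0)
            - if S w then 2 ^ (h + 1) - 1 else 0) := by ring
      have h2 := dyadicWeight_add_le J L (A - if S (b :: w) then 2 ^ (h + 1) - 1 else 0)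
        ((if S (b :: w) then (2 : ℤ) ^ (h + 1) - 1 else 0) - if S w then 2 ^ (h + 1) - 1 else 0)
      rw [← hsplit] at h2
      have h3 : dyadicWeight J L ((if S (b :: w) then (2 : ℤ) ^ (h + 1) - 1 else 0)
          - if S w then 2 ^ (h + 1) - 1 else 0)
          ≤ 2 * ((if X (b :: w) then 1 else 0) + if X w then 1 else 0) := by
        have hc := hSX b w (by omega)
        have h5 := dyadicWeight_neg J L (2 ^ (h + 1) - 1)
        by_cases hs : S w <;> by_cases hs' : S (b :: w)
        · simp only [hs, hs', if_true, sub_self, dyadicWeight_zero]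
          split_ifs <;> norm_num
        · have hx : X (b :: w) ∨ X w := by tauto
          simp only [hs, hs', if_true, if_false, zero_sub]
          rw [h5]
          rcases hx with hx | hx <;> simp only [hx, if_true] <;> split_ifs <;> linarith
        · have hx : X (b :: w) ∨ X w := by tauto
          simp only [hs, hs', if_true, if_false, sub_zero]
          rcases hx with hx | hx <;> simp only [hx, if_true] <;> split_ifs <;> linarith
        · simp only [hs, hs', if_false, sub_self, dyadicWeight_zero]
          split_ifs <;> norm_num
      linarith
    have hf := step false
    have ht := step true
    simp only [treeSum]
    set A := treeSum (fun v => if S v then (1 : ℤ) else 0) h (false :: w)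
    set A' := treeSum (fun v => if S v then (1 : ℤ) else 0) h (true :: w)
    set B := treeSum (fun v => if X v then (1 : ℝ) else 0) h (false :: w)
    set B' := treeSum (fun v => if X v then (1 : ℝ) else 0) h (true :: w)
    -- The root is absorbed without cost: `2 ^ (h + 2) - 1 = 1 + 2 * (2 ^ (h + 1) - 1)`.
    have hsplit : ((if S w then (1 : ℤ) else 0) + (A + A') - if S w then 2 ^ (h + 1 + 1) - 1 else 0)
        = (A - if S w then 2 ^ (h + 1) - 1 else 0) + (A' - if S w then 2 ^ (h + 1) - 1 else 0) := by
      split_ifs <;> ring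
    rw [hsplit]
    have := dyadicWeight_add_le J L (A - if S w then 2 ^ (h + 1) - 1 else 0)
      (A' - if S w then 2 ^ (h + 1) - 1 else 0)
    linarith

end TreeSum

/-! ### Cuts of `T_r(P_{2r})` -/

section Cuts

variable {r : ℕ}

theorem sepGraph_adj {u v : SepVertex r} : (sepGraph r).Adj u v ↔
    ((∃ b : Bool, v.1.1 = b :: u.1.1) ∨ (∃ b : Bool, u.1.1 = b :: v.1.1)) ∧ u.2 = v.2 ∨
    (u.2.1 + 1 = v.2.1 ∨ v.2.1 + 1 = u.2.1) ∧ u.1 = v.1 := by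
  simp only [sepGraph, treeOfCopies, SimpleGraph.boxProd_adj, SimpleGraph.pathGraph_adj,
    completeBinaryTree]

open scoped Classical in
theorem card_neighborFinset_sepGraph_le (v : SepVertex r) :
    ((sepGraph r).neighborFinset v).card ≤ 5 := by
  obtain ⟨w, i⟩ := v
  let f : SepVertex r → List Bool × ℕ := fun x => (x.1.1, x.2.1)
  have hf : Function.Injective f := by
    rintro ⟨w, i⟩ ⟨w', i'⟩ h
    simp only [f, Prod.mk.injEq] at h
    exact Prod.ext (Subtype.ext h.1) (Fin.ext h.2)
  rw [← Finset.card_image_of_injective _ hf]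
  -- Two children, the parent and two neighbours on the path. Entries that are no vertices, or junk
  -- values of `tail` and of truncated subtraction, do no harm in an upper bound.
  refine (Finset.card_le_card (t := {(false :: w.1, i.1), (true :: w.1, i.1), (w.1.tail, i.1),
    (w.1, i.1 + 1), (w.1, i.1 - 1)}) ?_).trans Finset.card_le_five
  intro x hx₀
  obtain ⟨⟨w', i'⟩, hx, rfl⟩ := Finset.mem_image.1 hx₀
  rw [SimpleGraph.mem_neighborFinset, sepGraph_adj] at hx
  simp only [Finset.mem_insert, Finset.mem_singleton, f, Prod.mk.injEq]
  rcases hx with ⟨⟨b, hb⟩ | ⟨b, hb⟩, h⟩ | ⟨h | h, h'⟩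
  · simp only at hb h
    cases b <;> simp [hb, h]
  · simp only at hb h
    simp [hb, h]
  · simp only at h h'
    subst h'
    right; right; right; left
    exact ⟨rfl, h.symm⟩
  · simp only at h h'
    subst h'
    right; right; right; right
    exact ⟨rfl, by omega⟩

/-- `X` covers the edges of `T_r(P_{2r})` between `S` and its complement. -/
def CoversCut (S X : Finset (SepVertex r)) : Prop :=
  ∀ u v, (sepGraph r).Adj u v → u ∈ S → v ∉ S → u ∈ X ∨ v ∈ X

variable {S X : Finset (SepVertex r)}

theorem CoversCut.iff_or (h : CoversCut S X) {u v : SepVertex r} (huv : (sepGraph r).Adj u v) :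
    (u ∈ S ↔ v ∈ S) ∨ u ∈ X ∨ v ∈ X := by
  by_cases hu : u ∈ S <;> by_cases hv : v ∈ S
  · simp [hu, hv]
  · exact Or.inr (h u v huv hu hv)
  · exact Or.inr (h v u huv.symm hv hu).symm
  · simp [hu, hv]

/-- A copy of the path is connected, and without elements of `X` none of its edges crosses the cut.
-/
theorem CoversCut.row_iff (h : CoversCut S X) {w : BinNode r} (hw : ∀ i, (w, i) ∉ X)
    (i j : Fin (2 * r)) : (w, i) ∈ S ↔ (w, j) ∈ S := by
  have key : ∀ (n : ℕ) (hn : n < 2 * r), (w, (⟨n, hn⟩ : Fin (2 * r))) ∈ S ↔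
      (w, (⟨0, by omega⟩ : Fin (2 * r))) ∈ S := by
    intro n
    induction n with
    | zero => exact fun _ => Iff.rfl
    | succ n ih =>
      intro hn
      rw [← ih (by omega)]
      have hadj : (sepGraph r).Adj (w, ⟨n + 1, hn⟩) (w, ⟨n, by omega⟩) := by
        rw [sepGraph_adj]; simp
      rcases h.iff_or hadj with h | h | h
      · exact h
      · exact absurd h (hw _)
      · exact absurd h (hw _)
  rw [key i.1 i.2, key j.1 j.2]

open scoped Classical in
/-- The nodes of the tree whose copy of the vertex `i` belongs to `S`. -/
noncomputable def column (S : Finset (SepVertex r)) (i : Fin (2 * r)) : Finset (BinNode r) :=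
  Finset.univ.filter fun w => (w, i) ∈ S

theorem mem_column {i : Fin (2 * r)} {w : BinNode r} : w ∈ column S i ↔ (w, i) ∈ S := by
  simp [column]

theorem sum_card_column (S : Finset (SepVertex r)) : ∑ i, (column S i).card = S.card := by
  classical
  rw [Finset.card_eq_sum_card_fiberwise (f := Prod.snd) (t := Finset.univ) (fun _ _ => by simp)]
  refine Finset.sum_congr rfl fun i _ => ?_
  refine Finset.card_bij (fun w _ => (w, i)) ?_ ?_ ?_
  · intro w hw
    simpa using mem_column.1 hw
  · intro a _ b _ h
    exact (Prod.mk.inj h).1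
  · rintro ⟨w, j⟩ h
    simp only [Finset.mem_filter] at h
    obtain ⟨h, rfl⟩ := h
    exact ⟨w, mem_column.2 h, rfl⟩

/-- Two columns can differ only in rows that meet `X`, by `CoversCut.row_iff`. -/
theorem CoversCut.card_column_le (h : CoversCut S X) (i j : Fin (2 * r)) :
    (column S i).card ≤ (column S j).card + X.card := by
  classical
  have hsub : column S i ⊆ column S j ∪ X.image Prod.fst := by
    intro w hw
    rw [Finset.mem_union]
    by_cases hwX : ∀ k, (w, k) ∉ X
    · exact Or.inl (mem_column.2 ((h.row_iff hwX i j).1 (mem_column.1 hw)))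
    · push Not at hwX
      obtain ⟨k, hk⟩ := hwX
      exact Or.inr (Finset.mem_image.2 ⟨_, hk, rfl⟩)
  calc _ ≤ _ := Finset.card_le_card hsub
    _ ≤ _ := Finset.card_union_le _ _
    _ ≤ _ := Nat.add_le_add_left Finset.card_image_le _

open scoped Classical in
theorem treeSum_column {R : Type} [AddCommMonoidWithOne R] (S : Finset (SepVertex r))
    (i : Fin (2 * r)) :
    treeSum (fun v => if ∃ hv : v.length ≤ r, ((⟨v, hv⟩ : BinNode r), i) ∈ S then (1 : R) else 0)
      r [] = ((column S i).card : R) := by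
  rw [← sum_binNode, column, Finset.card_filter, Nat.cast_sum]
  refine Finset.sum_congr rfl fun w _ => ?_
  have : (∃ hv : w.1.length ≤ r, ((⟨w.1, hv⟩ : BinNode r), i) ∈ S) ↔ (w, i) ∈ S :=
    ⟨fun ⟨_, h⟩ => h, fun h => ⟨w.2, h⟩⟩
  simp only [this]
  split_ifs <;> simp

/-- A column is a copy of the tree, so the tree estimate applies; the `2` pays for the contribution
of the root. -/
theorem CoversCut.dyadicWeight_card_column_le (h : CoversCut S X) (J L : ℕ) (i : Fin (2 * r)) :
    dyadicWeight J L (column S i).card ≤ 2 + 6 * (column X i).card := by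
  classical
  have h1 := dyadicWeight_treeSum_sub_le J L
    (fun v => ∃ hv : v.length ≤ r, ((⟨v, hv⟩ : BinNode r), i) ∈ S)
    (fun v => ∃ hv : v.length ≤ r, ((⟨v, hv⟩ : BinNode r), i) ∈ X) r [] ?_
  · rw [treeSum_column, treeSum_column] at h1
    set P := ∃ hv : ([] : List Bool).length ≤ r, ((⟨[], hv⟩ : BinNode r), i) ∈ S
    set Q := ∃ hv : ([] : List Bool).length ≤ r, ((⟨[], hv⟩ : BinNode r), i) ∈ X
    have h2 : dyadicWeight J L (if P then 2 ^ (r + 1) - 1 else 0) ≤ 2 := by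
      split_ifs
      · exact dyadicWeight_two_pow_sub_one_le J L _
      · rw [dyadicWeight_zero]; norm_num
    have h3 := dyadicWeight_add_le J L
      ((column S i).card - if P then 2 ^ (r + 1) - 1 else 0) (if P then 2 ^ (r + 1) - 1 else 0)
    rw [sub_add_cancel] at h3
    have h4 : (0 : ℝ) ≤ if Q then 1 else 0 := by split_ifs <;> norm_num
    linarith
  · intro b u hu
    simp only [List.length_nil, zero_add] at hu
    have hadj : (sepGraph r).Adj ((⟨b :: u, hu⟩ : BinNode r), i) ((⟨u, hu.le⟩ : BinNode r), i) := by
      rw [sepGraph_adj]; simp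
    rcases h.iff_or hadj with h | h | h
    · exact Or.inl ⟨fun ⟨_, h'⟩ => ⟨hu.le, h.1 h'⟩, fun ⟨_, h'⟩ => ⟨hu, h.2 h'⟩⟩
    · exact Or.inr (Or.inl ⟨hu, h⟩)
    · exact Or.inr (Or.inr ⟨hu.le, h⟩)

/-- The graph is connected, so a proper nonempty `S` has a crossing edge. This settles small `r`. -/
theorem CoversCut.nonempty (h : CoversCut S X) (h0 : S.Nonempty) (h1 : S ≠ Finset.univ) :
    X.Nonempty := by
  rw [Finset.nonempty_iff_ne_empty]
  rintro rfl
  obtain ⟨s, hs⟩ := h0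
  have hcol : ∀ (i : Fin (2 * r)) (u : List Bool) (hu : u.length ≤ r),
      ((⟨u, hu⟩ : BinNode r), i) ∈ S ↔ ((⟨[], by simp⟩ : BinNode r), i) ∈ S := by
    intro i u
    induction u with
    | nil => exact fun _ => Iff.rfl
    | cons b u ih =>
      intro hu
      have hu' : u.length ≤ r := by simp at hu; omega
      rw [← ih hu']
      have hadj : (sepGraph r).Adj ((⟨b :: u, hu⟩ : BinNode r), i) ((⟨u, hu'⟩ : BinNode r), i) := by
        rw [sepGraph_adj]; simp
      simpa using h.iff_or hadj
  refine h1 (Finset.eq_univ_iff_forall.2 fun v => ?_)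
  rw [show v = ((⟨v.1.1, v.1.2⟩ : BinNode r), v.2) from rfl, hcol,
    h.row_iff (fun _ => by simp) v.2 s.2, ← hcol _ s.1.1 s.1.2]
  exact hs

theorem sq_le_two_pow_half (r : ℕ) : r ^ 2 ≤ 16 * 2 ^ (r / 2) := by
  have key : ∀ q : ℕ, (2 * q + 1) ^ 2 ≤ 16 * 2 ^ q := by
    intro q
    induction q with
    | zero => norm_num
    | succ q ih =>
      rcases Nat.lt_or_ge q 2 with hq | hq
      · interval_cases q <;> norm_num
      · rw [pow_succ 2 q]
        nlinarith
  exact (Nat.pow_le_pow_left (show r ≤ 2 * (r / 2) + 1 by omega) 2).trans (key _)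

/-- A balanced cut of `T_r(P_{2r})` is covered only by sets of size `Ω(r²)`. -/
theorem CoversCut.sq_le_card (hr : 1 ≤ r) (h : CoversCut S X)
    (hS : S.card = 2 * r * (2 ^ (r + 1) / 3)) : r ^ 2 ≤ 4000000 * X.card := by
  set m := 2 ^ (r + 1) / 3 with hm
  have h4 : 4 ≤ 2 ^ (r + 1) := by
    calc 4 = 2 ^ (1 + 1) := by norm_num
      _ ≤ 2 ^ (r + 1) := Nat.pow_le_pow_right (by norm_num) (by omega)
  have hX1 : 1 ≤ X.card := by
    refine Finset.card_pos.2 (h.nonempty ?_ ?_)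
    · rw [← Finset.card_pos, hS]
      have : 0 < m := by omega
      positivity
    · intro hSu
      rw [hSu, Finset.card_univ, Fintype.card_prod, Fintype.card_fin, card_binNode,
        mul_comm] at hS
      have := Nat.eq_of_mul_eq_mul_left (by omega) hS
      omega
  rcases Nat.lt_or_ge r 2000 with hr2 | hr2
  · nlinarith
  by_contra! hcon
  -- Scales from about `r / 2` to `r` are coarse enough to ignore an error of size `X.card ≤ 2 ^ J`,
  -- yet there are still about `r / 2` of them.
  set J := r / 2 with hJ
  have hXJ : (X.card : ℝ) ≤ 2 ^ J := by
    have h1 := sq_le_two_pow_half r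
    have h2 : X.card ≤ 2 ^ (r / 2) := by omega
    exact_mod_cast h2
  have hcol : ∀ i : Fin (2 * r), (r : ℝ) / 8 - 5 ≤ 6 * ((column X i).card : ℝ) := by
    intro i
    have h1 := h.dyadicWeight_card_column_le J (r / 2) i
    have h2 : ((r / 2 : ℕ) : ℝ) / 4 ≤ dyadicWeight J (r / 2) ((m : ℕ) : ℤ) :=
      le_dyadicWeight_two_pow_div_three (by omega) (by omega)
    have h3 := dyadicWeight_add_le J (r / 2) (m - (column S i).card : ℤ) (column S i).card
    rw [sub_add_cancel] at h3
    have h4 := dyadicWeight_le J (r / 2) (m - (column S i).card : ℤ)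
    -- The columns have average size exactly `m` and differ pairwise by at most `X.card`.
    have habs : |((m - (column S i).card : ℤ) : ℝ)| ≤ X.card := by
      have hsum := sum_card_column S
      rw [hS] at hsum
      have hup : 2 * r * m ≤ 2 * r * ((column S i).card + X.card) := by
        rw [← hsum]
        refine (Finset.sum_le_sum fun j _ => h.card_column_le j i).trans (le_of_eq ?_)
        simp
      have hlo : 2 * r * (column S i).card ≤ 2 * r * (m + X.card) := by
        rw [mul_add, ← hsum]
        have := Finset.sum_le_sum fun (j : Fin (2 * r)) (_ : j ∈ Finset.univ) =>
          h.card_column_le i j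
        rw [Finset.sum_add_distrib] at this
        simpa using this
      have hup' := Nat.le_of_mul_le_mul_left hup (by omega)
      have hlo' := Nat.le_of_mul_le_mul_left hlo (by omega)
      have : |(m - (column S i).card : ℤ)| ≤ X.card := by
        rw [abs_le]; constructor <;> omega
      exact_mod_cast this
    have h5 : 2 * |((m - (column S i).card : ℤ) : ℝ)| / 2 ^ J ≤ 2 := by
      rw [div_le_iff₀ (by positivity)]
      linarith
    have h6 : (r : ℝ) / 2 - 1 ≤ ((r / 2 : ℕ) : ℝ) := by
      have : r ≤ 2 * (r / 2) + 1 := by omega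
      have : (r : ℝ) ≤ 2 * ((r / 2 : ℕ) : ℝ) + 1 := by exact_mod_cast this
      linarith
    linarith
  -- Adding up all `2r` columns gives `6 * X.card ≥ 2r * (r / 8 - 5)`, impossible for `r ≥ 2000`
  -- under `hcon`.
  have hsum := Finset.sum_le_sum fun (i : Fin (2 * r)) (_ : i ∈ Finset.univ) => hcol i
  rw [← Finset.mul_sum, ← Nat.cast_sum, sum_card_column] at hsum
  simp only [Finset.sum_const, Finset.card_univ, Fintype.card_fin, nsmul_eq_mul] at hsum
  push_cast at hsum
  have hcon' : (4000000 * X.card : ℝ) < r ^ 2 := by exact_mod_cast hcon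
  have hr2' : (2000 : ℝ) ≤ r := by exact_mod_cast hr2
  nlinarith

end Cuts

/-! ### Size bounds for read-once programs -/

section Programs

variable {r : ℕ}

theorem exists_sepGraph_adj (hr : 1 ≤ r) : ∃ u v : SepVertex r, (sepGraph r).Adj u v :=
  ⟨(⟨[], by simp⟩, ⟨0, by omega⟩), (⟨[], by simp⟩, ⟨1, by omega⟩), by rw [sepGraph_adj]; simp⟩

theorem pow_le_card_edge_of_accepts_sepCNF (hr : 1 ≤ r) {H : MultiDigraph}
    {label : H.Edge → Option (Literal (SepVertex r))} {root leaf : H.Node}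
    (hro : IsReadOnce H label) (hacc : Accepts label root leaf (sepCNF r).Sat) :
    (33 / 32 : ℝ) ^ ((r : ℝ) ^ 2 / 4000000) ≤ Fintype.card H.Edge := by
  set T := ⌈(r : ℝ) ^ 2 / 4000000⌉₊ with hT
  have h4 : 4 ≤ 2 ^ (r + 1) := by
    calc 4 = 2 ^ (1 + 1) := by norm_num
      _ ≤ 2 ^ (r + 1) := Nat.pow_le_pow_right (by norm_num) (by omega)
  have key := pow_le_card_edge (M := 2 * r * (2 ^ (r + 1) / 3)) (T := T)
    card_neighborFinset_sepGraph_le hro hacc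
    (Nat.mul_pos (by omega) (by omega))
    (by
      rw [Fintype.card_prod, Fintype.card_fin, card_binNode, mul_comm]
      exact Nat.mul_le_mul_right _ (by omega))
    (exists_sepGraph_adj hr)
    (fun S X hS hX => by
      have h1 : r ^ 2 ≤ 4000000 * X.card := CoversCut.sq_le_card hr hX hS
      have h2 : (r : ℝ) ^ 2 ≤ 4000000 * X.card := by exact_mod_cast h1
      rw [hT, Nat.ceil_le, div_le_iff₀ (by norm_num)]
      linarith)
  have key' : (33 : ℝ) ^ T ≤ 32 ^ T * Fintype.card H.Edge := by exact_mod_cast key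
  calc (33 / 32 : ℝ) ^ ((r : ℝ) ^ 2 / 4000000) ≤ (33 / 32 : ℝ) ^ (T : ℝ) :=
        Real.rpow_le_rpow_of_exponent_le (by norm_num) (Nat.le_ceil _)
    _ = 33 ^ T / 32 ^ T := by rw [Real.rpow_natCast, div_pow]
    _ ≤ _ := by
      rw [div_le_iff₀ (by positivity)]
      linarith

theorem NROBP.le_size (hr : 1 ≤ r) (Z : NROBP (SepVertex r)) (hZ : Z.Computes (sepCNF r).Sat) :
    (33 / 32 : ℝ) ^ ((r : ℝ) ^ 2 / 4000000) ≤ Z.size :=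
  pow_le_card_edge_of_accepts_sepCNF hr (label := Z.label) Z.readOnce hZ

/-! ### Deterministic programs as labelled graphs. -/

variable {V : Type}

/-- The node reached from `u` by an edge for the answer `b`; the leaves get loops. -/
def ROBP.next (Z : ROBP V) (u : Z.Node) (b : Bool) : Z.Node :=
  match Z.kind u with
  | .leaf _ => u
  | .query _ next => next b

/-- The label of the edge that leaves `u` for the answer `b`; the loops at leaves have none. -/
def ROBP.edgeLabel (Z : ROBP V) (u : Z.Node) (b : Bool) : Option (Literal V) :=
  match Z.kind u with
  | .leaf _ => none
  | .query x _ => some (x, b)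

/-- The graph of a branching program, with loops at the leaves. -/
def ROBP.graph (Z : ROBP V) : MultiDigraph where
  Node := Z.Node
  Edge := Z.Node × Bool
  src e := e.1
  tgt e := Z.next e.1 e.2

/-- The labelling of the graph of a branching program. -/
def ROBP.label (Z : ROBP V) (e : Z.graph.Edge) : Option (Literal V) := Z.edgeLabel e.1 e.2

theorem ROBP.bpWalk_of_isWalk (Z : ROBP V) {u v : Z.Node} {p : List Z.graph.Edge}
    (hp : Z.graph.IsWalk u p v) : BPWalk Z.kind u (p.filterMap Z.label) v := by
  induction p generalizing u with
  | nil => exact hp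
  | cons e p ih =>
    obtain ⟨rfl, hp⟩ := hp
    have h := ih hp
    cases hk : Z.kind (Z.graph.src e) with
    | leaf c =>
      have h1 : Z.label e = none := by
        change Z.edgeLabel (Z.graph.src e) e.2 = _
        simp [ROBP.edgeLabel, hk]
      have h2 : Z.graph.tgt e = Z.graph.src e := by
        change Z.next (Z.graph.src e) e.2 = _
        unfold ROBP.next
        rw [hk]
      rw [List.filterMap_cons_none h1]
      rwa [h2] at h
    | query x next =>
      have h1 : Z.label e = some (x, e.2) := by
        change Z.edgeLabel (Z.graph.src e) e.2 = _
        simp [ROBP.edgeLabel, hk]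
      have h2 : Z.graph.tgt e = next e.2 := by
        change Z.next (Z.graph.src e) e.2 = _
        simp [ROBP.next, hk]
      rw [List.filterMap_cons_some h1]
      rw [h2] at h
      exact ⟨next e.2, ⟨next, hk, rfl⟩, h⟩

theorem ROBP.exists_isWalk_of_bpWalk (Z : ROBP V) {u v : Z.Node} {p : List (Literal V)}
    (hp : BPWalk Z.kind u p v) :
    ∃ q : List Z.graph.Edge, Z.graph.IsWalk u q v ∧ q.filterMap Z.label = p := by
  induction p generalizing u with
  | nil => exact ⟨[], hp, rfl⟩
  | cons l p ih =>
    obtain ⟨w, ⟨next, hk, rfl⟩, hp⟩ := hp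
    obtain ⟨q, hq, rfl⟩ := ih hp
    have h1 : Z.label (u, l.2) = some l := by simp [ROBP.label, ROBP.edgeLabel, hk]
    have h2 : Z.graph.tgt (u, l.2) = next l.2 := by simp [ROBP.graph, ROBP.next, hk]
    exact ⟨(u, l.2) :: q, ⟨rfl, by rw [h2]; exact hq⟩, List.filterMap_cons_some h1⟩

/-- The loops at leaves are unlabelled, so erasing them turns a walk into one of the program. The
graph is not acyclic, but the lower bound uses only the read-once and acceptance properties. -/
theorem ROBP.isReadOnce (Z : ROBP V) : IsReadOnce Z.graph Z.label := by
  intro u p v hp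
  have h := Z.readOnce u _ v (Z.bpWalk_of_isWalk hp)
  rw [List.Nodup, List.pairwise_map, List.pairwise_filterMap] at h
  exact h

theorem ROBP.accepts (Z : ROBP V) {F : (V → Bool) → Prop} (hZ : Z.Computes F) {t : Z.Node}
    (ht : Z.kind t = .leaf true) : Accepts (H := Z.graph) Z.label Z.root t F := by
  intro a
  rw [hZ a]
  constructor
  · rintro ⟨p, v, hp, hv, hpa⟩
    obtain rfl := Z.leaf_unique _ _ _ hv ht
    obtain ⟨q, hq, rfl⟩ := Z.exists_isWalk_of_bpWalk hp
    exact ⟨q, hq, fun e he l hl => hpa l (List.mem_filterMap.2 ⟨e, he, hl⟩)⟩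
  · rintro ⟨q, hq, hqa⟩
    refine ⟨_, t, Z.bpWalk_of_isWalk hq, ht, fun l hl => ?_⟩
    obtain ⟨e, he, hl⟩ := List.mem_filterMap.1 hl
    exact hqa e he l hl

theorem ROBP.le_size (hr : 1 ≤ r) (Z : ROBP (SepVertex r)) (hZ : Z.Computes (sepCNF r).Sat) :
    (33 / 32 : ℝ) ^ ((r : ℝ) ^ 2 / 8000000) ≤ Z.size := by
  obtain ⟨-, t, -, ht, -⟩ := (hZ fun _ => true).1 (graphCNF_sat_iff.2 fun _ _ _ => Or.inl rfl)
  have h1 := pow_le_card_edge_of_accepts_sepCNF hr Z.isReadOnce (Z.accepts hZ ht)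
  -- A one-node program computes a constant. With this, the number `2 * Z.size` of edges is at most
  -- `Z.size ^ 2`, which explains the halved exponent.
  have h2 : 2 ≤ Z.size := by
    by_contra! h
    have hsub : Subsingleton Z.Node := Fintype.card_le_one_iff_subsingleton.1 (by
      unfold ROBP.size at h; omega)
    have hroot : Z.kind Z.root = .leaf true := by rwa [Subsingleton.elim Z.root t]
    have hsat := (hZ fun _ => false).2 ⟨[], Z.root, rfl, hroot, by simp⟩
    obtain ⟨u, v, huv⟩ := exists_sepGraph_adj hr
    simpa using graphCNF_sat_iff.1 hsat u v huv
  have h3 : (Fintype.card Z.graph.Edge : ℝ) = Z.size * 2 := by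
    have : Fintype.card Z.graph.Edge = Z.size * 2 :=
      (Fintype.card_prod Z.Node Bool).trans (by simp [ROBP.size])
    exact_mod_cast this
  have h2' : (2 : ℝ) ≤ Z.size := by exact_mod_cast h2
  refine abs_le_of_sq_le_sq' ?_ (by positivity) |>.2
  rw [← Real.rpow_natCast, ← Real.rpow_mul (by norm_num)]
  have h4 : (r : ℝ) ^ 2 / 8000000 * ((2 : ℕ) : ℝ) = (r : ℝ) ^ 2 / 4000000 := by push_cast; ring
  rw [h4]
  nlinarith

end Programs

/-! ### A small decision-DNNF -/

section Circuit

open scoped Classical in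
/-- The set with the elements `a` and `b`. -/
noncomputable def pairFinset {α : Type} (a b : α) : Finset α := {a, b}

theorem mem_pairFinset {α : Type} {a b c : α} : c ∈ pairFinset a b ↔ c = a ∨ c = b := by
  simp [pairFinset]

theorem card_pairFinset_le {α : Type} (a b : α) : (pairFinset a b).card ≤ 2 := by
  classical
  exact Finset.card_le_two

variable {r : ℕ}

/-- The gates of the circuit: `node w i s` decides the variables of the copy of `w` from the
index `i` on, where `s` holds the values at the indices `< i` in this copy and the values at the
indices `≥ i` in the parent copy; `branch w i s b` is the case where the variable with index `i`
has the value `b`; the other gates are literals and constants. -/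
abbrev SepGate (r : ℕ) : Type :=
  (BinNode r × Fin (2 * r + 1) × (Fin (2 * r) → Bool)) ⊕
    ((BinNode r × Fin (2 * r) × (Fin (2 * r) → Bool) × Bool) ⊕ (Literal (SepVertex r) ⊕ Bool))

/-- The gate that decides the variables of the copy of `w` from the index `i` on. -/
abbrev SepGate.node (w : BinNode r) (i : Fin (2 * r + 1)) (s : Fin (2 * r) → Bool) : SepGate r :=
  Sum.inl (w, i, s)

/-- The gate for the case that the variable `(w, i)` has the value `b`. -/
abbrev SepGate.branch (w : BinNode r) (i : Fin (2 * r)) (s : Fin (2 * r) → Bool) (b : Bool) :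
    SepGate r :=
  Sum.inr (Sum.inl (w, i, s, b))

/-- The input gate of a literal. -/
abbrev SepGate.lit (l : Literal (SepVertex r)) : SepGate r := Sum.inr (Sum.inr (Sum.inl l))

/-- The input gate of a constant. -/
abbrev SepGate.const (b : Bool) : SepGate r := Sum.inr (Sum.inr (Sum.inr b))

/-- The child of `w` in the complete binary tree. -/
def BinNode.child (w : BinNode r) (h : w.1.length < r) (b : Bool) : BinNode r :=
  ⟨b :: w.1, by simpa using h⟩

/-- With the frontier values `s`, the variable with index `i` may have the value `b`. -/
def Allowed (s : Fin (2 * r) → Bool) (i : Fin (2 * r)) (b : Bool) : Prop :=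
  b = true ∨ (s i = true ∧ ∀ j : Fin (2 * r), j.1 + 1 = i.1 → s j = true)

open scoped Classical in
/-- The kinds of the gates. -/
noncomputable def SepGate.kind : SepGate r → GateKind (SepVertex r) (SepGate r)
  | Sum.inl (w, i, s) =>
    if h : i.1 < 2 * r then
      .or (pairFinset (SepGate.branch w ⟨i.1, h⟩ s true) (SepGate.branch w ⟨i.1, h⟩ s false))
    else if h' : w.1.length < r then
      .and (pairFinset (SepGate.node (w.child h' false) 0 s) (SepGate.node (w.child h' true) 0 s))
    else .const true
  | Sum.inr (Sum.inl (w, i, s, b)) =>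
    .and (pairFinset (SepGate.lit ((w, i), b))
      (if Allowed s i b then SepGate.node w i.succ (Function.update s i b)
        else SepGate.const false))
  | Sum.inr (Sum.inr (Sum.inl l)) => .lit l
  | Sum.inr (Sum.inr (Sum.inr b)) => .const b

/-- A rank function that decreases along the wires of the circuit. -/
def SepGate.rank : SepGate r → ℕ
  | Sum.inl (w, i, _) => 2 * ((r - w.1.length) * (2 * r + 1) + (2 * r - i.1)) + 2
  | Sum.inr (Sum.inl (w, i, _, _)) => 2 * ((r - w.1.length) * (2 * r + 1) + (2 * r - i.1)) + 1
  | Sum.inr (Sum.inr _) => 0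

theorem SepGate.kind_node_of_lt {w : BinNode r} {i : Fin (2 * r + 1)} {s : Fin (2 * r) → Bool}
    (h : i.1 < 2 * r) : SepGate.kind (SepGate.node w i s) =
      .or (pairFinset (SepGate.branch w ⟨i.1, h⟩ s true) (SepGate.branch w ⟨i.1, h⟩ s false)) := by
  simp [SepGate.kind, h]

theorem SepGate.kind_node_last {w : BinNode r} {i : Fin (2 * r + 1)} {s : Fin (2 * r) → Bool}
    (h : ¬ i.1 < 2 * r) (h' : w.1.length < r) : SepGate.kind (SepGate.node w i s) =
      .and (pairFinset (SepGate.node (w.child h' false) 0 s) (SepGate.node (w.child h' true) 0 s)) := by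
  simp [SepGate.kind, h, h']

theorem SepGate.kind_node_leaf {w : BinNode r} {i : Fin (2 * r + 1)} {s : Fin (2 * r) → Bool}
    (h : ¬ i.1 < 2 * r) (h' : ¬ w.1.length < r) :
    SepGate.kind (SepGate.node w i s) = .const true := by
  simp [SepGate.kind, h, h']

open scoped Classical in
theorem SepGate.kind_branch {w : BinNode r} {i : Fin (2 * r)} {s : Fin (2 * r) → Bool} {b : Bool} :
    SepGate.kind (SepGate.branch w i s b) = .and (pairFinset (SepGate.lit ((w, i), b))
      (if Allowed s i b then SepGate.node w i.succ (Function.update s i b)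
        else SepGate.const false)) := rfl

theorem SepGate.rank_lt {g h : SepGate r} (hg : h ∈ (SepGate.kind g).inputs) :
    h.rank < g.rank := by
  classical
  rcases g with ⟨w, i, s⟩ | ⟨w, i, s, b⟩ | l | b
  · by_cases hi : i.1 < 2 * r
    · rw [SepGate.kind_node_of_lt hi] at hg
      simp only [GateKind.inputs, mem_pairFinset] at hg
      rcases hg with rfl | rfl <;> simp [SepGate.rank]
    · by_cases hw : w.1.length < r
      · rw [SepGate.kind_node_last hi hw] at hg
        simp only [GateKind.inputs, mem_pairFinset] at hg
        obtain ⟨k, hk⟩ := Nat.exists_eq_add_of_lt hw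
        have h1 : r - w.1.length = k + 1 := by omega
        have h2 : ∀ b, r - (w.child hw b).1.length = k := by
          intro b
          simp only [BinNode.child, List.length_cons]
          omega
        -- Descending one level resets the index to `0`, a gain of `2r` against the level weight `2r
        -- + 1`.
        rcases hg with rfl | rfl <;> simp only [SepGate.rank, h1, h2, Fin.val_zero, add_mul] <;>
          omega
      · rw [SepGate.kind_node_leaf hi hw] at hg
        simp [GateKind.inputs] at hg
  · change h ∈ (SepGate.kind (SepGate.branch w i s b)).inputs at hg
    rw [SepGate.kind_branch] at hg
    simp only [GateKind.inputs, mem_pairFinset] at hg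
    have := i.2
    rcases hg with rfl | rfl
    · simp [SepGate.rank]
    · split_ifs
      · simp only [SepGate.rank, Fin.val_succ]
        omega
      · simp [SepGate.rank]
  · simp [SepGate.kind, GateKind.inputs] at hg
  · simp [SepGate.kind, GateKind.inputs] at hg

/-- The circuit that branches on the variables of `T_r(P_{2r})` copy by copy, from the root of
the tree downwards. -/
noncomputable def sepCircuit (r : ℕ) : DeMorganCircuit (SepVertex r) where
  Gate := SepGate r
  kind := SepGate.kind
  -- The root has no parent; an imaginary parent copy with all values true imposes no condition.
  output := SepGate.node ⟨[], by simp⟩ 0 fun _ => true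
  acyclic := Subrelation.wf (r := InvImage (· < ·) SepGate.rank) (fun h => SepGate.rank_lt h)
    (InvImage.wf _ Nat.lt_wfRel.wf)

/-- The variables on which a gate may depend. -/
def SepGate.scope : SepGate r → Set (SepVertex r)
  | Sum.inl (w, i, _) => {x | (x.1 = w ∧ i.1 ≤ x.2.1) ∨ ∃ b, b :: w.1 <:+ x.1.1}
  | Sum.inr (Sum.inl (w, i, _, _)) => {x | (x.1 = w ∧ i.1 ≤ x.2.1) ∨ ∃ b, b :: w.1 <:+ x.1.1}
  | Sum.inr (Sum.inr (Sum.inl l)) => {l.1}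
  | Sum.inr (Sum.inr (Sum.inr _)) => ∅

theorem SepGate.mem_scope_node {w : BinNode r} {i : Fin (2 * r + 1)} {s : Fin (2 * r) → Bool}
    {x : SepVertex r} : x ∈ SepGate.scope (SepGate.node w i s) ↔
      (x.1 = w ∧ i.1 ≤ x.2.1) ∨ ∃ b, b :: w.1 <:+ x.1.1 := Iff.rfl

theorem SepGate.scope_subset_of_child {w : BinNode r} (h : w.1.length < r) (b : Bool)
    {i : Fin (2 * r + 1)} {s : Fin (2 * r) → Bool} {x : SepVertex r}
    (hx : x ∈ SepGate.scope (SepGate.node (w.child h b) i s)) : b :: w.1 <:+ x.1.1 := by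
  rcases SepGate.mem_scope_node.1 hx with ⟨h1, -⟩ | ⟨c, hc⟩
  · rw [h1]; exact List.suffix_rfl
  · exact (List.suffix_cons c _).trans hc

theorem SepGate.scope_subset {g h : SepGate r} (hg : h ∈ (SepGate.kind g).inputs) :
    h.scope ⊆ g.scope := by
  classical
  rcases g with ⟨w, i, s⟩ | ⟨w, i, s, b⟩ | l | b
  · by_cases hi : i.1 < 2 * r
    · rw [SepGate.kind_node_of_lt hi] at hg
      simp only [GateKind.inputs, mem_pairFinset] at hg
      rcases hg with rfl | rfl <;> exact fun x hx => hx
    · by_cases hw : w.1.length < r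
      · rw [SepGate.kind_node_last hi hw] at hg
        simp only [GateKind.inputs, mem_pairFinset] at hg
        rcases hg with rfl | rfl <;>
          exact fun x hx => Or.inr ⟨_, SepGate.scope_subset_of_child hw _ hx⟩
      · rw [SepGate.kind_node_leaf hi hw] at hg
        simp [GateKind.inputs] at hg
  · change h ∈ (SepGate.kind (SepGate.branch w i s b)).inputs at hg
    rw [SepGate.kind_branch] at hg
    simp only [GateKind.inputs, mem_pairFinset] at hg
    rcases hg with rfl | rfl
    · rintro x rfl
      exact Or.inl ⟨rfl, le_rfl⟩
    · split_ifs
      · rintro x (⟨h1, h2⟩ | h1)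
        · refine Or.inl ⟨h1, ?_⟩
          rw [Fin.val_succ] at h2
          omega
        · exact Or.inr h1
      · simp [SepGate.scope]
  · simp [SepGate.kind, GateKind.inputs] at hg
  · simp [SepGate.kind, GateKind.inputs] at hg

/-- Scopes only grow along wires, so decomposability can be checked on the explicit scopes. -/
theorem vReach_sepCircuit_subset (g : SepGate r) : (sepCircuit r).VReach g ⊆ g.scope := by
  rintro x ⟨h, b, hk, hr⟩
  have hx : x ∈ SepGate.scope h := by
    change SepGate.kind h = _ at hk
    rcases h with ⟨w, i, s⟩ | ⟨w, i, s, c⟩ | l | c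
    · exfalso
      simp only [SepGate.kind] at hk
      split_ifs at hk
    · simp [SepGate.kind] at hk
    · obtain rfl := GateKind.lit.inj hk
      exact Set.mem_singleton _
    · simp [SepGate.kind] at hk
  induction hr with
  | refl => exact hx
  | tail _ h1 ih => exact SepGate.scope_subset h1 ih

/-- Every copy involved is indexed by a word ending in `false :: w` or `true :: w`, and no word has
both suffixes. -/
theorem disjoint_scope_child {w : BinNode r} (h : w.1.length < r) {i j : Fin (2 * r + 1)}
    {s t : Fin (2 * r) → Bool} :
    Disjoint (SepGate.scope (SepGate.node (w.child h false) i s))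
      (SepGate.scope (SepGate.node (w.child h true) j t)) := by
  rw [Set.disjoint_left]
  intro x h1 h2
  obtain ⟨u, hu⟩ := SepGate.scope_subset_of_child h _ h1
  obtain ⟨v, hv⟩ := SepGate.scope_subset_of_child h _ h2
  have := List.append_inj_right' (hu.trans hv.symm) (by simp)
  simp at this

theorem disjoint_scope_branch {w : BinNode r} {i : Fin (2 * r)} {t : Fin (2 * r) → Bool}
    {b : Bool} {p : Prop} [Decidable p] :
    Disjoint (SepGate.scope (SepGate.lit ((w, i), b)))
      (SepGate.scope (if p then SepGate.node w i.succ t else SepGate.const false)) := by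
  rw [Set.disjoint_left]
  rintro x rfl h
  split_ifs at h
  · rcases SepGate.mem_scope_node.1 h with ⟨-, h⟩ | ⟨c, h⟩
    · simp at h
    · have := h.length_le
      simp at this
  · exact h

theorem isDNNF_sepCircuit (r : ℕ) : (sepCircuit r).IsDNNF := by
  classical
  intro g s hs h₁ hh₁ h₂ hh₂ hne
  refine Disjoint.mono (vReach_sepCircuit_subset h₁) (vReach_sepCircuit_subset h₂) ?_
  change SepGate.kind g = _ at hs
  rcases g with ⟨w, i, s⟩ | ⟨w, i, s, b⟩ | l | b
  · by_cases hi : i.1 < 2 * r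
    · rw [SepGate.kind_node_of_lt hi] at hs
      simp at hs
    · by_cases hw : w.1.length < r
      · rw [SepGate.kind_node_last hi hw] at hs
        obtain rfl := GateKind.and.inj hs
        rcases mem_pairFinset.1 hh₁ with rfl | rfl <;> rcases mem_pairFinset.1 hh₂ with rfl | rfl
        · exact absurd rfl hne
        · exact disjoint_scope_child hw
        · exact (disjoint_scope_child hw).symm
        · exact absurd rfl hne
      · rw [SepGate.kind_node_leaf hi hw] at hs
        simp at hs
  · obtain rfl := GateKind.and.inj (SepGate.kind_branch.symm.trans hs)
    rcases mem_pairFinset.1 hh₁ with rfl | rfl <;> rcases mem_pairFinset.1 hh₂ with rfl | rfl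
    · exact absurd rfl hne
    · exact disjoint_scope_branch
    · exact disjoint_scope_branch.symm
    · exact absurd rfl hne
  · simp [SepGate.kind] at hs
  · simp [SepGate.kind] at hs

theorem isDecisionDNNF_sepCircuit (r : ℕ) : (sepCircuit r).IsDecisionDNNF := by
  classical
  refine ⟨isDNNF_sepCircuit r, fun g s hs => ?_⟩
  have hs' : SepGate.kind g = .or s := hs
  rcases g with ⟨w, i, t⟩ | ⟨w, i, t, b⟩ | l | b
  · by_cases hi : i.1 < 2 * r
    · rw [SepGate.kind_node_of_lt hi] at hs'
      obtain rfl := GateKind.or.inj hs'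
      refine ⟨_, SepGate.branch w ⟨i.1, hi⟩ t true, SepGate.branch w ⟨i.1, hi⟩ t false, _, _,
        SepGate.lit ((w, ⟨i.1, hi⟩), true), SepGate.lit ((w, ⟨i.1, hi⟩), false), (w, ⟨i.1, hi⟩),
        hs, ?_, ?_, SepGate.kind_branch, ?_, rfl, SepGate.kind_branch, ?_, rfl⟩
      · exact fun h => by simpa using Sum.inl.inj (Sum.inr.inj h)
      · exact fun h => mem_pairFinset
      · exact mem_pairFinset.2 (Or.inl rfl)
      · exact mem_pairFinset.2 (Or.inl rfl)
    · by_cases hw : w.1.length < r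
      · rw [SepGate.kind_node_last hi hw] at hs'
        simp at hs'
      · rw [SepGate.kind_node_leaf hi hw] at hs'
        simp at hs'
  · simp [SepGate.kind] at hs'
  · simp [SepGate.kind] at hs'
  · simp [SepGate.kind] at hs'

end Circuit

/-! ### The function of the circuit and its size -/

section CircuitSemantics

section Holds

variable {V : Type} {D : DeMorganCircuit V} {a : V → Bool} {g : D.Gate}

theorem DeMorganCircuit.holds_const_iff {b : Bool} (hk : D.kind g = .const b) :
    D.Holds a g ↔ b = true := by
  constructor
  · intro h
    cases h <;> simp_all
  · rintro rfl
    exact .const hk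

theorem DeMorganCircuit.holds_lit_iff {l : Literal V} (hk : D.kind g = .lit l) :
    D.Holds a g ↔ l.Holds a := by
  constructor
  · intro h
    cases h <;> simp_all
  · exact .lit hk

theorem DeMorganCircuit.holds_and_pair_iff {h₁ h₂ : D.Gate}
    (hk : D.kind g = .and (pairFinset h₁ h₂)) : D.Holds a g ↔ D.Holds a h₁ ∧ D.Holds a h₂ := by
  constructor
  · intro h
    cases h with
    | and hs hh =>
      obtain rfl := GateKind.and.inj (hk.symm.trans hs)
      exact ⟨hh _ (mem_pairFinset.2 (Or.inl rfl)), hh _ (mem_pairFinset.2 (Or.inr rfl))⟩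
    | _ => simp_all
  · rintro ⟨h1, h2⟩
    refine .and hk fun h hh => ?_
    rcases mem_pairFinset.1 hh with rfl | rfl
    · exact h1
    · exact h2

theorem DeMorganCircuit.holds_or_pair_iff {h₁ h₂ : D.Gate}
    (hk : D.kind g = .or (pairFinset h₁ h₂)) : D.Holds a g ↔ D.Holds a h₁ ∨ D.Holds a h₂ := by
  constructor
  · intro h
    cases h with
    | or hs hm hh =>
      obtain rfl := GateKind.or.inj (hk.symm.trans hs)
      rcases mem_pairFinset.1 hm with rfl | rfl
      · exact Or.inl hh
      · exact Or.inr hh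
    | _ => simp_all
  · rintro (h | h)
    · exact .or hk (mem_pairFinset.2 (Or.inl rfl)) h
    · exact .or hk (mem_pairFinset.2 (Or.inr rfl)) h

end Holds

variable {r : ℕ}

theorem holds_iff_of_kind_eq_const {a : SepVertex r → Bool} {g : SepGate r} {b : Bool}
    (hk : g.kind = .const b) : (sepCircuit r).Holds a g ↔ b = true :=
  DeMorganCircuit.holds_const_iff (D := sepCircuit r) hk

theorem holds_iff_of_kind_eq_and {a : SepVertex r → Bool} {g h₁ h₂ : SepGate r}
    (hk : g.kind = .and (pairFinset h₁ h₂)) :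
    (sepCircuit r).Holds a g ↔ (sepCircuit r).Holds a h₁ ∧ (sepCircuit r).Holds a h₂ :=
  DeMorganCircuit.holds_and_pair_iff (D := sepCircuit r) hk

theorem holds_iff_of_kind_eq_or {a : SepVertex r → Bool} {g h₁ h₂ : SepGate r}
    (hk : g.kind = .or (pairFinset h₁ h₂)) :
    (sepCircuit r).Holds a g ↔ (sepCircuit r).Holds a h₁ ∨ (sepCircuit r).Holds a h₂ :=
  DeMorganCircuit.holds_or_pair_iff (D := sepCircuit r) hk

/-- The values at the copy of `w`, those at the indices `< i` being given by `s`. -/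
def frontierVals (a : SepVertex r → Bool) (w : BinNode r) (i : ℕ) (s : Fin (2 * r) → Bool) :
    Fin (2 * r) → Bool :=
  fun j => if j.1 < i then s j else a (w, j)

/-- The clauses with a variable `(w, j)`, `i ≤ j`, and a variable that comes before it
are satisfied. -/
def RowSat (a : SepVertex r → Bool) (w : BinNode r) (i : ℕ) (s : Fin (2 * r) → Bool) : Prop :=
  ∀ j : Fin (2 * r), i ≤ j.1 → (a (w, j) = true ∨ s j = true) ∧
    ∀ k : Fin (2 * r), k.1 + 1 = j.1 → a (w, j) = true ∨ frontierVals a w i s k = true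

/-- The clauses below the copy of `w` are satisfied, down to `h` levels, where `s` gives the
values at the copy of `w`. -/
def BelowSat (a : SepVertex r → Bool) : ℕ → BinNode r → (Fin (2 * r) → Bool) → Prop
  | 0, _, _ => True
  | h + 1, w, s => ∀ (hw : w.1.length < r) (b : Bool),
      RowSat a (w.child hw b) 0 s ∧ BelowSat a h (w.child hw b) fun j => a (w.child hw b, j)

theorem frontierVals_zero (a : SepVertex r → Bool) (w : BinNode r) (s : Fin (2 * r) → Bool) :
    frontierVals a w 0 s = fun j => a (w, j) := by
  funext j
  simp [frontierVals]

theorem frontierVals_update (a : SepVertex r → Bool) (w : BinNode r) (i : Fin (2 * r))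
    (s : Fin (2 * r) → Bool) :
    frontierVals a w (i.1 + 1) (Function.update s i (a (w, i))) = frontierVals a w i.1 s := by
  funext j
  unfold frontierVals
  rcases lt_trichotomy j.1 i.1 with h | h | h
  · have : j ≠ i := fun h' => by simp [h'] at h
    simp [h, this, Nat.lt_succ_of_lt h]
  · obtain rfl := Fin.ext h
    simp
  · have h1 : ¬ j.1 < i.1 := by omega
    have h2 : ¬ j.1 < i.1 + 1 := by omega
    simp [h1, h2]

/-- `Allowed` collects the clauses joining `(w, i)` to its parent copy and to index `i - 1`.
Afterwards the parent's value at `i` is no longer needed, so its slot in `s` can be overwritten. -/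
theorem rowSat_iff (a : SepVertex r → Bool) (w : BinNode r) (i : Fin (2 * r))
    (s : Fin (2 * r) → Bool) : RowSat a w i.1 s ↔
      Allowed s i (a (w, i)) ∧ RowSat a w (i.1 + 1) (Function.update s i (a (w, i))) := by
  unfold RowSat
  rw [frontierVals_update]
  have hup : ∀ j : Fin (2 * r), i.1 + 1 ≤ j.1 → Function.update s i (a (w, i)) j = s j := by
    intro j hj
    have : j ≠ i := fun h' => by simp [h'] at hj
    simp [this]
  have hfr : ∀ k : Fin (2 * r), k.1 + 1 = i.1 → frontierVals a w i.1 s k = s k := by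
    intro k hk
    have : k.1 < i.1 := by omega
    simp [frontierVals, this]
  constructor
  · intro h
    refine ⟨?_, fun j hj => ?_⟩
    · unfold Allowed
      obtain ⟨h1, h2⟩ := h i le_rfl
      by_cases ha : a (w, i) = true
      · exact Or.inl ha
      · refine Or.inr ⟨h1.resolve_left ha, fun k hk => ?_⟩
        rw [← hfr k hk]
        exact (h2 k hk).resolve_left ha
    · rw [hup j hj]
      exact h j (by omega)
  · rintro ⟨h1, h2⟩ j hj
    rcases Nat.eq_or_lt_of_le hj with hj | hj
    · obtain rfl := Fin.ext hj
      rcases h1 with h1 | ⟨h1, h3⟩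
      · exact ⟨Or.inl h1, fun _ _ => Or.inl h1⟩
      · refine ⟨Or.inr h1, fun k hk => Or.inr ?_⟩
        rw [hfr k hk]
        exact h3 k hk
    · have := h2 j hj
      rwa [hup j hj] at this

theorem holds_branch_iff (a : SepVertex r → Bool) (w : BinNode r) (i : Fin (2 * r))
    (s : Fin (2 * r) → Bool) (b : Bool) : (sepCircuit r).Holds a (SepGate.branch w i s b) ↔
      a (w, i) = b ∧ Allowed s i b ∧
        (sepCircuit r).Holds a (SepGate.node w i.succ (Function.update s i b)) := by
  classical
  rw [holds_iff_of_kind_eq_and SepGate.kind_branch]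
  refine and_congr (DeMorganCircuit.holds_lit_iff (D := sepCircuit r)
    (g := SepGate.lit ((w, i), b)) (l := ((w, i), b)) rfl) ?_
  split_ifs with h
  · simp [h]
  · rw [holds_iff_of_kind_eq_const (b := false) rfl]
    simp [h]

theorem holds_node_iff_of_lt (a : SepVertex r → Bool) (w : BinNode r) (i : Fin (2 * r))
    (s : Fin (2 * r) → Bool) : (sepCircuit r).Holds a (SepGate.node w i.castSucc s) ↔
      Allowed s i (a (w, i)) ∧
        (sepCircuit r).Holds a (SepGate.node w i.succ (Function.update s i (a (w, i)))) := by
  rw [holds_iff_of_kind_eq_or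
    (SepGate.kind_node_of_lt (i := i.castSucc) i.2)]
  rw [holds_branch_iff, holds_branch_iff]
  simp only [Fin.val_castSucc, Fin.eta]
  cases a (w, i) <;> simp

/-- Induction on the height, and inside it downwards on the index. A completed copy has its own
values as frontier, which is what both children receive. -/
theorem holds_node_iff (a : SepVertex r → Bool) (h : ℕ) (w : BinNode r) (hw : w.1.length + h = r)
    (i : Fin (2 * r + 1)) (s : Fin (2 * r) → Bool) :
    (sepCircuit r).Holds a (SepGate.node w i s) ↔
      RowSat a w i.1 s ∧ BelowSat a h w (frontierVals a w i.1 s) := by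
  induction h generalizing w i s with
  | zero =>
    induction i using Fin.reverseInduction generalizing s with
    | last =>
      rw [holds_iff_of_kind_eq_const
        (SepGate.kind_node_leaf (by simp) (by omega))]
      refine ⟨fun _ => ⟨fun j hj => ?_, trivial⟩, fun _ => rfl⟩
      have := j.2
      simp only [Fin.val_last] at hj
      omega
    | cast i ih =>
      rw [holds_node_iff_of_lt, ih, Fin.val_castSucc, rowSat_iff, and_assoc, Fin.val_succ,
        frontierVals_update]
  | succ h ihh =>
    induction i using Fin.reverseInduction generalizing s with
    | last =>
      have hlt : w.1.length < r := by omega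
      rw [holds_iff_of_kind_eq_and
        (SepGate.kind_node_last (by simp) hlt)]
      rw [ihh _ (by simp only [BinNode.child, List.length_cons]; omega),
        ihh _ (by simp only [BinNode.child, List.length_cons]; omega)]
      have hfr : frontierVals a w (Fin.last (2 * r)).1 s = s := by
        funext j
        simp [frontierVals]
      rw [hfr, Fin.val_zero, frontierVals_zero, frontierVals_zero]
      constructor
      · rintro ⟨h1, h2⟩
        refine ⟨fun j hj => ?_, fun _ b => ?_⟩
        · have := j.2
          simp only [Fin.val_last] at hj
          omega
        · cases b
          · exact h1
          · exact h2
      · rintro ⟨-, h1⟩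
        exact ⟨h1 hlt false, h1 hlt true⟩
    | cast i ih =>
      rw [holds_node_iff_of_lt, ih, Fin.val_castSucc, rowSat_iff, and_assoc, Fin.val_succ,
        frontierVals_update]

theorem rowSat_zero_iff (a : SepVertex r → Bool) (w : BinNode r) (s : Fin (2 * r) → Bool) :
    RowSat a w 0 s ↔ (∀ j, a (w, j) = true ∨ s j = true) ∧
      ∀ j k : Fin (2 * r), k.1 + 1 = j.1 → a (w, j) = true ∨ a (w, k) = true := by
  unfold RowSat
  rw [frontierVals_zero]
  exact ⟨fun h => ⟨fun j => (h j (Nat.zero_le _)).1, fun j => (h j (Nat.zero_le _)).2⟩,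
    fun h j _ => ⟨h.1 j, h.2 j⟩⟩

theorem belowSat_of_sat {a : SepVertex r → Bool} (ha : (sepCNF r).Sat a) (h : ℕ) (w : BinNode r) :
    BelowSat a h w fun j => a (w, j) := by
  have hadj := graphCNF_sat_iff.1 ha
  induction h generalizing w with
  | zero => trivial
  | succ h ih =>
    refine fun hw b => ⟨(rowSat_zero_iff _ _ _).2 ⟨fun j => hadj _ _ ?_, fun j k hk => hadj _ _ ?_⟩,
      ih _⟩
    · rw [sepGraph_adj]; simp [BinNode.child]
    · rw [sepGraph_adj]; simp [hk]

theorem sat_of_belowSat {a : SepVertex r → Bool}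
    (h0 : RowSat a ⟨[], by simp⟩ 0 fun _ => true)
    (h1 : BelowSat a r ⟨[], by simp⟩ fun j => a (⟨[], by simp⟩, j)) : (sepCNF r).Sat a := by
  have key : ∀ (u : List Bool) (hu : u.length ≤ r),
      (∀ j k : Fin (2 * r), k.1 + 1 = j.1 → a (⟨u, hu⟩, j) = true ∨ a (⟨u, hu⟩, k) = true) ∧
      BelowSat a (r - u.length) ⟨u, hu⟩ fun j => a (⟨u, hu⟩, j) := by
    intro u
    induction u with
    | nil => exact fun hu => ⟨((rowSat_zero_iff _ _ _).1 h0).2, h1⟩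
    | cons b u ih =>
      intro hu
      have hlt : u.length < r := hu
      have h2 := (ih hlt.le).2
      rw [show r - u.length = (r - (b :: u).length) + 1 by simp only [List.length_cons]; omega]
        at h2
      obtain ⟨h3, h4⟩ := h2 hlt b
      exact ⟨((rowSat_zero_iff _ _ _).1 h3).2, h4⟩
  have hchild : ∀ (w v : BinNode r) (b : Bool) (j : Fin (2 * r)), v.1 = b :: w.1 →
      a (v, j) = true ∨ a (w, j) = true := by
    rintro ⟨w, hw⟩ ⟨v, hv⟩ b j h
    simp only at h
    subst h
    have hlt : w.length < r := hv
    have h2 := (key w hw).2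
    rw [show r - w.length = (r - (b :: w).length) + 1 by simp only [List.length_cons]; omega]
      at h2
    exact ((rowSat_zero_iff _ _ _).1 (h2 hlt b).1).1 j
  refine graphCNF_sat_iff.2 ?_
  rintro ⟨u, i⟩ ⟨v, j⟩ huv
  rcases sepGraph_adj.1 huv with ⟨⟨b, hb⟩ | ⟨b, hb⟩, h⟩ | ⟨h | h, h'⟩
  · obtain rfl : i = j := h
    exact (hchild u v b i hb).symm
  · obtain rfl : i = j := h
    exact hchild v u b i hb
  · obtain rfl : u = v := h'
    exact ((key u.1 u.2).1 j i h).symm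
  · obtain rfl : u = v := h'
    exact (key u.1 u.2).1 i j h

theorem computes_sepCircuit (r : ℕ) : (sepCircuit r).Computes (sepCNF r).Sat := by
  intro a
  have h := holds_node_iff a r ⟨[], by simp⟩ (by simp) 0 fun _ => true
  rw [Fin.val_zero, frontierVals_zero] at h
  refine Iff.trans ?_ h.symm
  constructor
  · intro ha
    refine ⟨(rowSat_zero_iff _ _ _).2 ⟨fun _ => Or.inr rfl, fun j k hk => ?_⟩,
      belowSat_of_sat ha r _⟩
    exact graphCNF_sat_iff.1 ha _ _ (by rw [sepGraph_adj]; simp [hk])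
  · exact fun ⟨h0, h1⟩ => sat_of_belowSat h0 h1

theorem card_inputs_le (g : SepGate r) : (SepGate.kind g).inputs.card ≤ 2 := by
  rcases g with ⟨w, i, s⟩ | ⟨w, i, s, b⟩ | l | b
  · simp only [SepGate.kind]
    split_ifs
    · exact card_pairFinset_le _ _
    · exact card_pairFinset_le _ _
    · simp [GateKind.inputs]
  · exact card_pairFinset_le _ _
  · simp [SepGate.kind, GateKind.inputs]
  · simp [SepGate.kind, GateKind.inputs]

theorem sepNumVars_eq (r : ℕ) : sepNumVars r = (2 ^ (r + 1) - 1) * (2 * r) := by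
  rw [sepNumVars, Fintype.card_prod, Fintype.card_fin, card_binNode]

theorem size_sepCircuit_le (hr : 1 ≤ r) : (sepCircuit r).size ≤ 30 * sepNumVars r ^ 3 := by
  have h1 : (sepCircuit r).size ≤ 3 * Fintype.card (SepGate r) := by
    have h2 : ∑ g : SepGate r, (SepGate.kind g).inputs.card ≤ ∑ _g : SepGate r, 2 :=
      Finset.sum_le_sum fun g _ => card_inputs_le g
    rw [Finset.sum_const, Finset.card_univ, smul_eq_mul] at h2
    change Fintype.card (SepGate r) + ∑ g : SepGate r, (SepGate.kind g).inputs.card ≤ _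
    omega
  have h3 : Fintype.card (SepGate r) =
      (2 ^ (r + 1) - 1) * ((2 * r + 1) * 2 ^ (2 * r)) +
      ((2 ^ (r + 1) - 1) * (2 * r * (2 ^ (2 * r) * 2)) +
        ((2 ^ (r + 1) - 1) * (2 * r) * 2 + 2)) := by
    simp only [Fintype.card_sum, Fintype.card_prod, Fintype.card_fin, card_binNode,
      Fintype.card_bool, Fintype.card_pi, Finset.prod_const, Finset.card_univ]
  rw [h3] at h1
  rw [sepNumVars_eq]
  set N := 2 ^ (r + 1) - 1 with hN
  have hNr : 2 ^ r ≤ N := by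
    have : 1 ≤ 2 ^ r := Nat.one_le_two_pow
    rw [hN, pow_succ]
    omega
  -- The path length `2r` is chosen so that the number of frontiers stays polynomial in the size of
  -- the tree.
  have h4 : 2 ^ (2 * r) ≤ N ^ 2 := by
    rw [mul_comm, pow_mul]
    exact Nat.pow_le_pow_left hNr 2
  have hN1 : 1 ≤ N := Nat.one_le_two_pow.trans hNr
  set n := N * (2 * r) with hn
  have hNn : N ≤ n := Nat.le_mul_of_pos_right _ (by omega)
  have h5 : 2 ^ (2 * r) ≤ n ^ 2 := h4.trans (Nat.pow_le_pow_left hNn 2)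
  have h6 : N * (2 * r + 1) ≤ 2 * n := by
    rw [hn]
    nlinarith
  have hn1 : 1 ≤ n := hN1.trans hNn
  have h7 : N * ((2 * r + 1) * 2 ^ (2 * r)) ≤ 2 * n ^ 3 := by
    calc _ = (N * (2 * r + 1)) * 2 ^ (2 * r) := by ring
      _ ≤ (2 * n) * n ^ 2 := Nat.mul_le_mul h6 h5
      _ = _ := by ring
  have h8 : N * (2 * r * (2 ^ (2 * r) * 2)) ≤ 2 * n ^ 3 := by
    calc _ = 2 * n * 2 ^ (2 * r) := by rw [hn]; ring
      _ ≤ (2 * n) * n ^ 2 := Nat.mul_le_mul_left _ h5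
      _ = _ := by ring
  have h9 : n ≤ n ^ 3 := Nat.le_self_pow (by norm_num) n
  omega

theorem sepNumVars_le (r : ℕ) : sepNumVars r ≤ 2 ^ (2 * r + 1) := by
  have h : 2 * r ≤ 2 ^ r := by
    induction r with
    | zero => norm_num
    | succ r ih =>
      rcases Nat.eq_zero_or_pos r with rfl | hr
      · norm_num
      · rw [pow_succ]
        omega
  rw [sepNumVars_eq]
  calc _ ≤ 2 ^ (r + 1) * 2 ^ r := Nat.mul_le_mul (Nat.sub_le _ _) h
    _ = _ := by rw [← pow_add]; congr 1; ring

end CircuitSemantics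

/-! ### Combining the size bounds. -/

/-- The left side is `2 ^ ((logb 2 x) ^ 2 / c)` with `logb 2 x ≤ 14 * r`, and `196 = 14 ^ 2`. -/
theorem rpow_logb_div_le {x y c δ r : ℝ} (hr : 0 ≤ r) (hx : 1 ≤ x) (hxr : x ≤ 2 ^ (14 * r))
    (hδ : 0 < δ) (hc : c = 196 / δ) (hy : 2 ^ (δ * r ^ 2) ≤ y) :
    x ^ (Real.logb 2 x / c) ≤ y := by
  have hl0 : 0 ≤ Real.logb 2 x := Real.logb_nonneg (by norm_num) hx
  have hl1 : Real.logb 2 x ≤ 14 * r := by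
    rw [Real.logb_le_iff_le_rpow (by norm_num) (by linarith)]
    exact hxr
  have hx2 : x = 2 ^ Real.logb 2 x := (Real.rpow_logb (by norm_num) (by norm_num) (by linarith)).symm
  refine le_trans ?_ hy
  conv_lhs => rw [hx2, Real.logb_rpow (by norm_num) (by norm_num)]
  rw [← Real.rpow_mul (by norm_num)]
  refine Real.rpow_le_rpow_of_exponent_le (by norm_num) ?_
  rw [hc, div_div_eq_mul_div, mul_div_assoc', div_le_iff₀ (by norm_num)]
  have h1 : Real.logb 2 x * Real.logb 2 x ≤ (14 * r) * (14 * r) :=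
    mul_le_mul hl1 hl1 hl0 (by positivity)
  nlinarith

theorem mainTheorem2 :
    ∃ C c : ℝ, 0 < C ∧ 0 < c ∧ ∀ r : ℕ, 1 ≤ r →
      ∃ D : DeMorganCircuit (SepVertex r),
        D.IsDecisionDNNF ∧
        D.Computes (sepCNF r).Sat ∧
        (D.size : ℝ) ≤ C * (sepNumVars r : ℝ) ^ 5 ∧
        (∀ Z : NROBP (SepVertex r), Z.Computes (sepCNF r).Sat →
          (sepNumVars r : ℝ) ^ (Real.logb 2 (sepNumVars r : ℝ) / c) ≤ (Z.size : ℝ) ∧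
          (D.size : ℝ) ^ (Real.logb 2 (D.size : ℝ) / c) ≤ (Z.size : ℝ)) ∧
        (∀ Z : ROBP (SepVertex r), Z.Computes (sepCNF r).Sat →
          (sepNumVars r : ℝ) ^ (Real.logb 2 (sepNumVars r : ℝ) / c) ≤ (Z.size : ℝ) ∧
          (D.size : ℝ) ^ (Real.logb 2 (D.size : ℝ) / c) ≤ (Z.size : ℝ)) := by
  -- The weaker, deterministic exponent serves both program models.
  set δ : ℝ := Real.logb 2 (33 / 32) / 8000000 with hδ
  have hδ0 : 0 < δ := div_pos (Real.logb_pos (by norm_num) (by norm_num)) (by norm_num)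
  refine ⟨30, 196 / δ, by norm_num, by positivity, fun r hr => ⟨sepCircuit r,
    isDecisionDNNF_sepCircuit r, computes_sepCircuit r, ?_, ?_⟩⟩
  all_goals
    have hr' : (1 : ℝ) ≤ r := by exact_mod_cast hr
    have hn1 : 1 ≤ sepNumVars r := by
      rw [sepNumVars_eq]
      have : 2 ≤ 2 ^ (r + 1) := by
        calc 2 = 2 ^ 1 := by norm_num
          _ ≤ 2 ^ (r + 1) := Nat.pow_le_pow_right (by norm_num) (by omega)
      exact Nat.mul_pos (by omega) (by omega)
    have hD := size_sepCircuit_le hr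
  · have h1 : (sepCircuit r).size ≤ 30 * sepNumVars r ^ 5 :=
      hD.trans (Nat.mul_le_mul_left _ (Nat.pow_le_pow_right hn1 (by norm_num)))
    exact_mod_cast h1
  · have hn14 : (sepNumVars r : ℝ) ≤ 2 ^ (14 * (r : ℝ)) := by
      have h1 : sepNumVars r ≤ 2 ^ (14 * r) :=
        (sepNumVars_le r).trans (Nat.pow_le_pow_right (by norm_num) (by omega))
      have h2 : (sepNumVars r : ℝ) ≤ 2 ^ (14 * r) := by exact_mod_cast h1
      rw [← Real.rpow_natCast] at h2
      exact_mod_cast h2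
    have hD14 : ((sepCircuit r).size : ℝ) ≤ 2 ^ (14 * (r : ℝ)) := by
      -- The constant `14` is `6 + 8`: the cubic bound gives `2 ^ (6 * r + 8)`, and `1 ≤ r`.
      have h1 : (sepCircuit r).size ≤ 2 ^ (14 * r) := by
        calc _ ≤ 30 * sepNumVars r ^ 3 := hD
          _ ≤ 2 ^ 5 * (2 ^ (2 * r + 1)) ^ 3 :=
            Nat.mul_le_mul (by norm_num) (Nat.pow_le_pow_left (sepNumVars_le r) 3)
          _ = 2 ^ (6 * r + 8) := by rw [← pow_mul, ← pow_add]; congr 1; ring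
          _ ≤ _ := Nat.pow_le_pow_right (by norm_num) (by omega)
      have h2 : ((sepCircuit r).size : ℝ) ≤ 2 ^ (14 * r) := by exact_mod_cast h1
      rw [← Real.rpow_natCast] at h2
      exact_mod_cast h2
    have hD1 : (1 : ℝ) ≤ (sepCircuit r).size := by
      have h1 : 0 < Fintype.card (sepCircuit r).Gate :=
        Fintype.card_pos_iff.2 ⟨(sepCircuit r).output⟩
      have h2 : 1 ≤ (sepCircuit r).size := by
        unfold DeMorganCircuit.size
        omega
      exact_mod_cast h2
    have hn1' : (1 : ℝ) ≤ sepNumVars r := by exact_mod_cast hn1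
    have hpow : (2 : ℝ) ^ (δ * (r : ℝ) ^ 2) = (33 / 32 : ℝ) ^ ((r : ℝ) ^ 2 / 8000000) := by
      rw [hδ, div_mul_eq_mul_div, mul_div_assoc, Real.rpow_mul (by norm_num),
        Real.rpow_logb (by norm_num) (by norm_num) (by norm_num)]
    have key : ∀ y : ℝ, (33 / 32 : ℝ) ^ ((r : ℝ) ^ 2 / 8000000) ≤ y →
        (sepNumVars r : ℝ) ^ (Real.logb 2 (sepNumVars r : ℝ) / (196 / δ)) ≤ y ∧
        ((sepCircuit r).size : ℝ) ^ (Real.logb 2 ((sepCircuit r).size : ℝ) / (196 / δ)) ≤ y := by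
      intro y hy
      rw [← hpow] at hy
      exact ⟨rpow_logb_div_le (by linarith) hn1' hn14 hδ0 rfl hy,
        rpow_logb_div_le (by linarith) hD1 hD14 hδ0 rfl hy⟩
    refine ⟨fun Z hZ => key _ (le_trans ?_ (Z.le_size hr hZ)), fun Z hZ => key _ (Z.le_size hr hZ)⟩
    refine Real.rpow_le_rpow_of_exponent_le (by norm_num) ?_
    have : (0 : ℝ) ≤ (r : ℝ) ^ 2 := by positivity
    linarith
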